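/- **Setting.** All Hilbert spaces are complex; inner products and sesquilinear forms are linear in the first argument. For a Hilbert space $\mathcal H$, $\mathcal H^*$ is its anti-dual (bounded conjugate-linear functionals), with pairing $\langle\varphi,x\rangle_{\mathcal H^*,\mathcal H}=\varphi(x)$ and $\langle x,\varphi\rangle_{\mathcal H,\mathcal H^*}=\overline{\varphi(x)}$. The domain of an operator $A$ carries the graph norm $\|x\|_{\operatorname{dom}(A)}=(\|x\|^2+\|Ax\|^2)^{1/2}$. *System node.* A system node on the Hilbert spaces $(\mathcal X,\mathcal U,\mathcal Y)$ consists of a closed linear operator $A\&B:\mathcal X\times\mathcal U\supset\operatorname{dom}(A\&B)\to\mathcal X$ and a bounded operator $C\&D\in\mathcal L(\operatorname{dom}(A\&B),\mathcal Y)$ such that for every $u\in\mathcal U$ there is $x\in\mathcal X$ with $(x,u)\in\operatorname{dom}(A\&B)$, and such that the main operator $Ax:=A\&B(x,0)$ with $\operatorname{dom}(A)=\{x\in\mathcal X:(x,0)\in\operatorname{dom}(A\&B)\}$ generates a strongly continuous semigroup on $\mathcal X$. A classical trajectory on $[0,T]$ is a triple $(x,u,y)\in C^1([0,T];\mathcal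 X)\times C([0,T];\mathcal U)\times C([0,T];\mathcal Y)$ with $(x(t),u(t))\in\operatorname{dom}(A\&B)$, $\dot x(t)=A\&B(x(t),u(t))$ and $y(t)=C\&D(x(t),u(t))$ for all $t\in[0,T]$. *Spaces.* Let $\mathcal V=\{x\in\mathcal X:\exists u\in\mathcal U,\ (x,u)\in\operatorname{dom}(A\&B)\}$ with $\|x\|_{\mathcal V}=\inf\{\|(x,u)\|_{\operatorname{dom}(A\&B)}:(x,u)\in\operatorname{dom}(A\&B)\}$, and $\mathcal W=\{(x,u)\in\operatorname{dom}(A\&B):A\&B(x,u)\in\mathcal V\}$ with $\|(x,u)\|_{\mathcal W}^2=\|(x,u)\|_{\mathcal X\times\mathcal U}^2+\|A\&B(x,u)\|_{\mathcal V}^2$. *Supply rate.* Let $Q=Q^*\in\mathcal L(\mathcal Y)$, $S\in\mathcal L(\mathcal U,\mathcal Y)$, $R=R^*\in\mathcal L(\mathcal U)$ and $s(y,u)=\langle y,Qy+Su\rangle_{\mathcal Y}+\langle u,S^*y+Ru\rangle_{\mathcal U}\in\mathbb R$. *Storage function.* Let $\mathcal S:\operatorname{dom}(\mathcal S)\to\mathbb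 R$, with $\operatorname{dom}(\mathcal S)\subset\mathcal X$ a dense subspace, be a real quadratic form: its polarization $h(x,z)=\tfrac14\big(\mathcal S(x+z)-\mathcal S(x-z)+i\,\mathcal S(x+iz)-i\,\mathcal S(x-iz)\big)$ is sesquilinear and $\mathcal S(x)=h(x,x)$. Let $\mathcal S$ be semi-bounded and closed: for some $\varepsilon\in\{1,-1\}$ and $c\ge 0$ there is $\delta>0$ with $\varepsilon\mathcal S(x)+c\|x\|^2\ge\delta\|x\|^2$ on $\operatorname{dom}(\mathcal S)$, and $\operatorname{dom}(\mathcal S)$ is complete with respect to the norm $(\varepsilon\mathcal S(x)+c\|x\|^2)^{1/2}$. Equip $\operatorname{dom}(\mathcal S)$ with this norm, and let $\widetilde P\in\mathcal L(\operatorname{dom}(\mathcal S),\operatorname{dom}(\mathcal S)^*)$ be such that $h(x,z)=\langle x,\widetilde Pz\rangle_{\operatorname{dom}(\mathcal S),\operatorname{dom}(\mathcal S)^*}$ for all $x,z\in\operatorname{dom}(\mathcal S)$. **Theorem.** The following statements are equivalent. (i) For every $T>0$ and every classical trajectory $(x,u,y)$ on $[0,T]$, one has $x(0),x(T)\in\operatorname{dom}(\mathcal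 S)$ and $$\mathcal S(x(T))-\mathcal S(x(0))+\int_0^T s(y(t),u(t))\,dt\ \ge\ 0 .$$ (ii) $\mathcal V\subset\operatorname{dom}(\mathcal S)$, and there is a dense subspace $\widetilde{\mathcal W}$ of $\mathcal W$ such that for all $(x,u)\in\widetilde{\mathcal W}$ $$2\operatorname{Re}\langle\widetilde Px,\,A\&B(x,u)\rangle+s\big(C\&D(x,u),u\big)\ \ge\ 0, \tag{$*$}$$ where $\langle\cdot,\cdot\rangle$ is the pairing of an anti-linear functional with an element of $\mathcal V\subset\operatorname{dom}(\mathcal S)$. (iii) $\mathcal V\subset\operatorname{dom}(\mathcal S)$, and $(*)$ holds for all $(x,u)\in\mathcal W$. (iv) $\mathcal V\subset\operatorname{dom}(\mathcal S)$, and there are a Hilbert space $\mathcal Z$ and an operator $K\&L\in\mathcal L(\mathcal W,\mathcal Z)$ with dense range such that for all $(x,u)\in\mathcal W$ $$2\operatorname{Re}\langle\widetilde Px,\,A\&B(x,u)\rangle+s\big(C\&D(x,u),u\big)=\|K\&L(x,u)\|_{\mathcal Z}^2 .$$ -/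

import Mathlib

open Filter Topology Set
open scoped NNReal ComplexConjugate

universe uX uU uY

noncomputable section

/-! ### Graph norms -/

/-- The domain of a linear operator `A : E ⊃ dom A → F`, to be equipped with the graph norm
`‖v‖ = (‖v‖_E ^ 2 + ‖A v‖_F ^ 2) ^ (1/2)`. -/
def GraphSpace {E F : Type*} [NormedAddCommGroup E] [InnerProductSpace ℂ E]
    [NormedAddCommGroup F] [InnerProductSpace ℂ F] (A : E →ₗ.[ℂ] F) : Type _ := A.domain

namespace GraphSpace

variable {E F : Type*} [NormedAddCommGroup E] [InnerProductSpace ℂ E]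
  [NormedAddCommGroup F] [InnerProductSpace ℂ F] (A : E →ₗ.[ℂ] F)

instance : AddCommGroup (GraphSpace A) := inferInstanceAs (AddCommGroup A.domain)
instance : Module ℂ (GraphSpace A) := inferInstanceAs (Module ℂ A.domain)

/-- The identification of `GraphSpace A` with the submodule `A.domain`. -/
def equivDomain : GraphSpace A ≃ₗ[ℂ] A.domain := LinearEquiv.refl ℂ A.domain

/-- The embedding `v ↦ (v, A v)` into the Hilbert space product `E × F`. -/
def toGraph : GraphSpace A →ₗ[ℂ] WithLp 2 (E × F) :=
  (WithLp.linearEquiv 2 ℂ (E × F)).symm.toLinearMap ∘ₗ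
    (A.domain.subtype.prod A.toFun) ∘ₗ (equivDomain A).toLinearMap

theorem toGraph_injective : Function.Injective (toGraph A) := by
  intro v w h
  have h1 : (WithLp.fst (toGraph A v)) = WithLp.fst (toGraph A w) := by rw [h]
  exact Subtype.ext h1

instance : NormedAddCommGroup (GraphSpace A) :=
  NormedAddCommGroup.induced (GraphSpace A) (WithLp 2 (E × F)) (toGraph A) (toGraph_injective A)

instance : NormedSpace ℂ (GraphSpace A) :=
  NormedSpace.induced ℂ (GraphSpace A) (WithLp 2 (E × F)) (toGraph A)

theorem norm_sq (v : GraphSpace A) :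
    ‖v‖ ^ 2 = ‖((equivDomain A v : A.domain) : E)‖ ^ 2 + ‖A (equivDomain A v)‖ ^ 2 :=
  WithLp.prod_norm_sq_eq_of_L2 (toGraph A v)

end GraphSpace

/-! ### Strongly continuous semigroups -/

/-- `T` is a strongly continuous semigroup of bounded operators on `X`. -/
structure IsC0Semigroup {X : Type*} [NormedAddCommGroup X] [NormedSpace ℂ X]
    (T : ℝ≥0 → X →L[ℂ] X) : Prop where
  map_zero : T 0 = ContinuousLinearMap.id ℂ X
  map_add : ∀ s t, T (s + t) = (T s).comp (T t)
  tendsto_zero : ∀ x, Tendsto (fun t => T t x) (𝓝 0) (𝓝 x)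

/-- `A` is the generator of `T`: the pair `(x, y)` lies in the graph of `A` exactly when
`(T t x - x) / t` tends to `y` as `t ↘ 0`. -/
def IsGeneratorOf {X : Type*} [NormedAddCommGroup X] [NormedSpace ℂ X]
    (A : X →ₗ.[ℂ] X) (T : ℝ≥0 → X →L[ℂ] X) : Prop :=
  ∀ x y, (x, y) ∈ A.graph ↔
    Tendsto (fun t : ℝ≥0 => ((t : ℝ) : ℂ)⁻¹ • (T t x - x)) (𝓝[>] 0) (𝓝 y)

/-! ### System nodes -/

/-- The main operator `A x = A&B (x, 0)` with domain `{x | (x, 0) ∈ dom (A&B)}`. -/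
def mainOperator {X : Type uX} {U : Type uU}
    [NormedAddCommGroup X] [InnerProductSpace ℂ X] [NormedAddCommGroup U] [InnerProductSpace ℂ U]
    (AB : WithLp 2 (X × U) →ₗ.[ℂ] X) : X →ₗ.[ℂ] X :=
  let ι : X →ₗ[ℂ] WithLp 2 (X × U) :=
    (WithLp.linearEquiv 2 ℂ (X × U)).symm.toLinearMap ∘ₗ LinearMap.inl ℂ X U
  { domain := AB.domain.comap ι
    toFun := AB.toFun ∘ₗ ι.restrict (p := AB.domain.comap ι) (q := AB.domain) (fun _ h => h) }

/-- A system node on the triple `(X, U, Y)` of complex Hilbert spaces. -/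
structure SystemNode (X : Type uX) (U : Type uU) (Y : Type uY)
    [NormedAddCommGroup X] [InnerProductSpace ℂ X]
    [NormedAddCommGroup U] [InnerProductSpace ℂ U]
    [NormedAddCommGroup Y] [InnerProductSpace ℂ Y] where
  /-- The operator `A&B : X × U ⊃ dom (A&B) → X`. -/
  AB : WithLp 2 (X × U) →ₗ.[ℂ] X
  AB_isClosed : AB.IsClosed
  /-- The operator `C&D`, bounded from `dom (A&B)` with the graph norm to `Y`. -/
  CD : GraphSpace AB →L[ℂ] Y
  exists_state : ∀ u : U, ∃ x : X, WithLp.toLp 2 (x, u) ∈ AB.domain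
  generates : ∃ T : ℝ≥0 → X →L[ℂ] X, IsC0Semigroup T ∧ IsGeneratorOf (mainOperator AB) T

namespace SystemNode

variable {X : Type uX} {U : Type uU} {Y : Type uY}
  [NormedAddCommGroup X] [InnerProductSpace ℂ X]
  [NormedAddCommGroup U] [InnerProductSpace ℂ U]
  [NormedAddCommGroup Y] [InnerProductSpace ℂ Y] (𝔖 : SystemNode X U Y)

/-- State component `(x, u) ↦ x` on `dom (A&B)`. -/
def stateOf : GraphSpace 𝔖.AB →ₗ[ℂ] X :=
  LinearMap.fst ℂ X U ∘ₗ (WithLp.linearEquiv 2 ℂ (X × U)).toLinearMap ∘ₗ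
    𝔖.AB.domain.subtype ∘ₗ (GraphSpace.equivDomain 𝔖.AB).toLinearMap

/-- Input component `(x, u) ↦ u` on `dom (A&B)`. -/
def inputOf : GraphSpace 𝔖.AB →ₗ[ℂ] U :=
  LinearMap.snd ℂ X U ∘ₗ (WithLp.linearEquiv 2 ℂ (X × U)).toLinearMap ∘ₗ
    𝔖.AB.domain.subtype ∘ₗ (GraphSpace.equivDomain 𝔖.AB).toLinearMap

/-- `A&B` as a linear map on its domain. -/
def applyAB : GraphSpace 𝔖.AB →ₗ[ℂ] X :=
  𝔖.AB.toFun ∘ₗ (GraphSpace.equivDomain 𝔖.AB).toLinearMap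

/-- The element `(x, u)` of `dom (A&B)`. -/
def pair (x : X) (u : U) (h : WithLp.toLp 2 (x, u) ∈ 𝔖.AB.domain) : GraphSpace 𝔖.AB :=
  (GraphSpace.equivDomain 𝔖.AB).symm ⟨WithLp.toLp 2 (x, u), h⟩

/-- A classical trajectory on `[0, T]`: `x` is `C¹`, `u` and `y` are continuous, and
`x' (t) = A&B (x t, u t)`, `y t = C&D (x t, u t)` for all `t ∈ [0, T]` (with one-sided derivatives
at the end points). Only the values on `[0, T]` matter. -/
structure IsClassicalTrajectory (T : ℝ) (x : ℝ → X) (u : ℝ → U) (y : ℝ → Y) : Prop where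
  state : ContDiffOn ℝ 1 x (Icc 0 T)
  input : ContinuousOn u (Icc 0 T)
  output : ContinuousOn y (Icc 0 T)
  eqn : ∀ t ∈ Icc 0 T, ∃ h : WithLp.toLp 2 (x t, u t) ∈ 𝔖.AB.domain,
    HasDerivWithinAt x (𝔖.applyAB (𝔖.pair (x t) (u t) h)) (Icc 0 T) t ∧
      y t = 𝔖.CD (𝔖.pair (x t) (u t) h)

/-- The space `V = {x | ∃ u, (x, u) ∈ dom (A&B)}`, as a subspace of `X`. -/
def V : Submodule ℂ X := LinearMap.range 𝔖.stateOf

/-- The space `V`, to be equipped with the norm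
`‖x‖_V = inf {‖(x, u)‖_{dom (A&B)} | (x, u) ∈ dom (A&B)}`. -/
def VSpace : Type uX := 𝔖.V

instance : AddCommGroup 𝔖.VSpace := inferInstanceAs (AddCommGroup 𝔖.V)
instance : Module ℂ 𝔖.VSpace := inferInstanceAs (Module ℂ 𝔖.V)

/-- The identification of `VSpace` with the subspace `V` of `X`. -/
def equivV : 𝔖.VSpace ≃ₗ[ℂ] 𝔖.V := LinearEquiv.refl ℂ 𝔖.V

instance : Norm 𝔖.VSpace where
  norm x := sInf {r : ℝ | ∃ v : GraphSpace 𝔖.AB, 𝔖.stateOf v = 𝔖.equivV x ∧ r = ‖v‖}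

theorem VSpace.norm_def (x : 𝔖.VSpace) :
    ‖x‖ = sInf {r : ℝ | ∃ v : GraphSpace 𝔖.AB, 𝔖.stateOf v = 𝔖.equivV x ∧ r = ‖v‖} := rfl

theorem VSpace.norm_le (x : 𝔖.VSpace) (v : GraphSpace 𝔖.AB)
    (h : 𝔖.stateOf v = 𝔖.equivV x) : ‖x‖ ≤ ‖v‖ :=
  csInf_le ⟨0, by rintro r ⟨w, -, rfl⟩; exact norm_nonneg w⟩ ⟨v, h, rfl⟩

theorem VSpace.le_norm (x : 𝔖.VSpace) (c : ℝ)
    (h : ∀ v : GraphSpace 𝔖.AB, 𝔖.stateOf v = 𝔖.equivV x → c ≤ ‖v‖) : c ≤ ‖x‖ := by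
  refine le_csInf ?_ (by rintro r ⟨v, hv, rfl⟩; exact h v hv)
  obtain ⟨v, hv⟩ := (𝔖.equivV x).2
  exact ⟨_, v, hv, rfl⟩

theorem norm_stateOf_le (v : GraphSpace 𝔖.AB) : ‖𝔖.stateOf v‖ ≤ ‖v‖ := by
  have h1 := GraphSpace.norm_sq 𝔖.AB v
  have h2 := WithLp.prod_norm_sq_eq_of_L2
    ((GraphSpace.equivDomain 𝔖.AB v : 𝔖.AB.domain) : WithLp 2 (X × U))
  refine abs_le_of_sq_le_sq' ?_ (norm_nonneg v) |>.2
  change ‖(WithLp.fst ((GraphSpace.equivDomain 𝔖.AB v : 𝔖.AB.domain) : WithLp 2 (X × U)))‖ ^ 2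
    ≤ _
  rw [h1, h2]
  nlinarith [sq_nonneg ‖𝔖.AB (GraphSpace.equivDomain 𝔖.AB v)‖, sq_nonneg
    ‖(WithLp.snd ((GraphSpace.equivDomain 𝔖.AB v : 𝔖.AB.domain) : WithLp 2 (X × U)))‖]

theorem VSpace.core : NormedSpace.Core ℂ 𝔖.VSpace where
  norm_nonneg x := VSpace.le_norm 𝔖 x 0 fun v _ => norm_nonneg v
  norm_smul c x := by
    have key : ∀ (c : ℂ) (x : 𝔖.VSpace), ‖c • x‖ ≤ ‖c‖ * ‖x‖ := by
      intro c x
      rcases eq_or_ne c 0 with rfl | hc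
      · refine (VSpace.norm_le 𝔖 _ 0 ?_).trans (by simp)
        simp
      · have hc' : 0 < ‖c‖ := norm_pos_iff.2 hc
        rw [mul_comm, ← div_le_iff₀ hc']
        refine VSpace.le_norm 𝔖 x _ fun v hv => ?_
        rw [div_le_iff₀ hc', mul_comm, ← norm_smul]
        refine VSpace.norm_le 𝔖 _ _ ?_
        simp [hv]
    refine le_antisymm (key c x) ?_
    rcases eq_or_ne c 0 with rfl | hc
    · simpa using VSpace.le_norm 𝔖 _ 0 fun v _ => norm_nonneg v
    · have hc' : 0 < ‖c‖ := norm_pos_iff.2 hc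
      have := key c⁻¹ (c • x)
      rw [inv_smul_smul₀ hc, norm_inv, inv_mul_eq_div, le_div_iff₀ hc'] at this
      linarith
  norm_triangle x y := by
    rw [← sub_le_iff_le_add]
    refine VSpace.le_norm 𝔖 _ _ fun w hw => ?_
    rw [sub_le_comm]
    refine VSpace.le_norm 𝔖 _ _ fun v hv => ?_
    rw [sub_le_iff_le_add]
    refine (VSpace.norm_le 𝔖 (x + y) (w + v) ?_).trans ((norm_add_le w v).trans ?_)
    · simp [hw, hv]
    · linarith
  norm_eq_zero_iff x := by
    constructor
    · intro h
      have h1 : ‖(𝔖.equivV x : X)‖ ≤ 0 := by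
        rw [← h]
        exact VSpace.le_norm 𝔖 x _ fun v hv => hv ▸ 𝔖.norm_stateOf_le v
      exact Subtype.ext (norm_le_zero_iff.1 h1)
    · rintro rfl
      refine le_antisymm ((VSpace.norm_le 𝔖 _ 0 (by simp)).trans (by simp)) ?_
      exact VSpace.le_norm 𝔖 _ 0 fun v _ => norm_nonneg v

instance : NormedAddCommGroup 𝔖.VSpace := NormedAddCommGroup.ofCore (VSpace.core 𝔖)

instance : NormedSpace ℂ 𝔖.VSpace := NormedSpace.ofCore (VSpace.core 𝔖)

/-- The space `W = {(x, u) ∈ dom (A&B) | A&B (x, u) ∈ V}`, to be equipped with the norm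
`‖(x, u)‖_W ^ 2 = ‖(x, u)‖_{X × U} ^ 2 + ‖A&B (x, u)‖_V ^ 2`. -/
def W : Type (max uX uU) := 𝔖.V.comap 𝔖.applyAB

instance : AddCommGroup 𝔖.W := inferInstanceAs (AddCommGroup (𝔖.V.comap 𝔖.applyAB))
instance : Module ℂ 𝔖.W := inferInstanceAs (Module ℂ (𝔖.V.comap 𝔖.applyAB))

/-- The inclusion of `W` into `dom (A&B)`. -/
def ofW : 𝔖.W →ₗ[ℂ] GraphSpace 𝔖.AB := (𝔖.V.comap 𝔖.applyAB).subtype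

/-- `A&B` as a map from `W` to `V`. -/
def applyABV : 𝔖.W →ₗ[ℂ] 𝔖.VSpace :=
  𝔖.equivV.symm.toLinearMap ∘ₗ
    𝔖.applyAB.restrict (p := 𝔖.V.comap 𝔖.applyAB) (q := 𝔖.V) (fun _ h => h)

/-- The embedding `(x, u) ↦ ((x, u), A&B (x, u))` of `W` into the product of `X × U` and `V`. -/
def embW : 𝔖.W →ₗ[ℂ] WithLp 2 (WithLp 2 (X × U) × 𝔖.VSpace) :=
  (WithLp.linearEquiv 2 ℂ (WithLp 2 (X × U) × 𝔖.VSpace)).symm.toLinearMap ∘ₗ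
    (𝔖.AB.domain.subtype ∘ₗ (GraphSpace.equivDomain 𝔖.AB).toLinearMap ∘ₗ 𝔖.ofW).prod 𝔖.applyABV

theorem embW_injective : Function.Injective 𝔖.embW := by
  intro v w h
  have h1 : (WithLp.fst (𝔖.embW v)) = WithLp.fst (𝔖.embW w) := by rw [h]
  exact Subtype.ext (Subtype.ext h1)

instance : NormedAddCommGroup 𝔖.W :=
  NormedAddCommGroup.induced 𝔖.W (WithLp 2 (WithLp 2 (X × U) × 𝔖.VSpace)) 𝔖.embW
    𝔖.embW_injective

instance : NormedSpace ℂ 𝔖.W :=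
  NormedSpace.induced ℂ 𝔖.W (WithLp 2 (WithLp 2 (X × U) × 𝔖.VSpace)) 𝔖.embW

theorem W.norm_sq (w : 𝔖.W) :
    ‖w‖ ^ 2 = ‖𝔖.stateOf (𝔖.ofW w)‖ ^ 2 + ‖𝔖.inputOf (𝔖.ofW w)‖ ^ 2
      + ‖𝔖.applyABV w‖ ^ 2 := by
  have h1 := WithLp.prod_norm_sq_eq_of_L2 (𝔖.embW w)
  have h2 := WithLp.prod_norm_sq_eq_of_L2 (WithLp.fst (𝔖.embW w))
  rw [h2] at h1
  exact h1

theorem stateOf_mem_V (v : GraphSpace 𝔖.AB) : 𝔖.stateOf v ∈ 𝔖.V := ⟨v, rfl⟩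

theorem applyAB_mem_V (w : 𝔖.W) : 𝔖.applyAB (𝔖.ofW w) ∈ 𝔖.V := (w : 𝔖.V.comap 𝔖.applyAB).2

end SystemNode

/-! ### Supply rates and storage functions -/

/-- The supply rate `s (y, u) = ⟨(y, u), [Q S; S* R] (y, u)⟩`, a real number when `Q` and `R` are
self-adjoint. -/
def supplyRate {U : Type uU} {Y : Type uY}
    [NormedAddCommGroup U] [InnerProductSpace ℂ U] [CompleteSpace U]
    [NormedAddCommGroup Y] [InnerProductSpace ℂ Y] [CompleteSpace Y]
    (Q : Y →L[ℂ] Y) (S : U →L[ℂ] Y) (R : U →L[ℂ] U) (y : Y) (u : U) : ℝ :=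
  (inner ℂ (Q y + S u) y + inner ℂ (ContinuousLinearMap.adjoint S y + R u) u).re

/-- The polarization `h` of a real-valued function on a complex vector space (linear in the first
argument for a quadratic form). -/
def polarForm {D : Type*} [AddCommGroup D] [Module ℂ D] (q : D → ℝ) (x z : D) : ℂ :=
  (1 / 4) * ((q (x + z) : ℂ) - q (x - z)
    + Complex.I * q (x + Complex.I • z) - Complex.I * q (x - Complex.I • z))

/-- A real quadratic form on a subspace of `X`: its polarization `h` is sesquilinear (linear in the
first, conjugate linear in the second argument) and `𝒮 x = h (x, x)`. -/
structure RealQuadraticForm (X : Type uX) [NormedAddCommGroup X] [InnerProductSpace ℂ X] where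
  dom : Submodule ℂ X
  toFun : dom → ℝ
  add_left : ∀ x y z, polarForm toFun (x + y) z = polarForm toFun x z + polarForm toFun y z
  smul_left : ∀ (c : ℂ) x z, polarForm toFun (c • x) z = c * polarForm toFun x z
  add_right : ∀ x y z, polarForm toFun x (y + z) = polarForm toFun x y + polarForm toFun x z
  smul_right : ∀ (c : ℂ) x z, polarForm toFun x (c • z) = conj c * polarForm toFun x z
  diag : ∀ x, polarForm toFun x x = toFun x

namespace RealQuadraticForm

variable {X : Type uX} [NormedAddCommGroup X] [InnerProductSpace ℂ X] (𝒮 : RealQuadraticForm X)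

/-- `x ↦ (ε 𝒮(x) + c ‖x‖ ^ 2) ^ (1/2)`, with `ε = ± 1` and `c ≥ 0`, defines a norm on `dom 𝒮` that is
at least as strong as the norm of `X` (up to a positive factor). The form `𝒮` is semi-bounded if and
only if there are such `ε` and `c`; any two norms arising in this way are equivalent. -/
def IsNormShift (ε c : ℝ) : Prop :=
  (ε = 1 ∨ ε = -1) ∧ 0 ≤ c ∧
    ∃ δ : ℝ, 0 < δ ∧ ∀ x : 𝒮.dom, δ * ‖(x : X)‖ ^ 2 ≤ ε * 𝒮.toFun x + c * ‖(x : X)‖ ^ 2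

theorem polar_conj_symm (x z : 𝒮.dom) :
    conj (polarForm 𝒮.toFun z x) = polarForm 𝒮.toFun x z := by
  have hs : ∀ (a : ℂ) (v : 𝒮.dom), a * conj a = 1 → 𝒮.toFun (a • v) = 𝒮.toFun v := by
    intro a v ha
    have h := 𝒮.diag (a • v)
    rw [𝒮.smul_left, 𝒮.smul_right, ← mul_assoc, ha, one_mul, 𝒮.diag] at h
    exact_mod_cast h.symm
  have hI : Complex.I * conj Complex.I = 1 := by simp
  have hm : (-1 : ℂ) * conj (-1 : ℂ) = 1 := by simp
  have e1 : 𝒮.toFun (z + x) = 𝒮.toFun (x + z) := by rw [add_comm]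
  have e2 : 𝒮.toFun (z - x) = 𝒮.toFun (x - z) := by
    rw [← hs (-1) (x - z) hm]; congr 1; simp
  have e3 : 𝒮.toFun (z + Complex.I • x) = 𝒮.toFun (x - Complex.I • z) := by
    rw [← hs Complex.I (x - Complex.I • z) hI]; congr 1
    rw [smul_sub, smul_smul, Complex.I_mul_I]; simp [add_comm]
  have e4 : 𝒮.toFun (z - Complex.I • x) = 𝒮.toFun (x + Complex.I • z) := by
    rw [← hs Complex.I (z - Complex.I • x) hI]; congr 1
    rw [smul_sub, smul_smul, Complex.I_mul_I]; simp [add_comm]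
  have h4 : conj (1 / 4 : ℂ) = 1 / 4 := by
    have := Complex.conj_ofReal (1 / 4)
    push_cast at this
    exact this
  unfold polarForm
  rw [e1, e2, e3, e4, map_mul, h4]
  simp only [map_add, map_sub, map_mul, Complex.conj_I, Complex.conj_ofReal]
  ring

/-- The domain of `𝒮`, to be equipped with the norm `(ε 𝒮(x) + c ‖x‖ ^ 2) ^ (1/2)`. -/
def FormSpace {ε c : ℝ} (_h : 𝒮.IsNormShift ε c) : Type uX := 𝒮.dom

namespace FormSpace

variable {𝒮} {ε c : ℝ} (hn : 𝒮.IsNormShift ε c)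

instance : AddCommGroup (𝒮.FormSpace hn) := inferInstanceAs (AddCommGroup 𝒮.dom)
instance : Module ℂ (𝒮.FormSpace hn) := inferInstanceAs (Module ℂ 𝒮.dom)

/-- The identification of `FormSpace` with the subspace `dom 𝒮` of `X`. -/
def equivDom : 𝒮.FormSpace hn ≃ₗ[ℂ] 𝒮.dom := LinearEquiv.refl ℂ 𝒮.dom

/-- The inner product `ε h(x, z) + c ⟨x, z⟩` (in Mathlib's order of arguments). -/
@[reducible] def core : InnerProductSpace.Core ℂ (𝒮.FormSpace hn) where
  inner x z := (ε : ℂ) * polarForm 𝒮.toFun (equivDom hn z) (equivDom hn x)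
    + (c : ℂ) * inner ℂ (equivDom hn x : X) (equivDom hn z : X)
  conj_inner_symm x z := by
    simp only [map_add, map_mul, Complex.conj_ofReal, polar_conj_symm, inner_conj_symm]
  re_inner_nonneg x := by
    obtain ⟨δ, hδ, h⟩ := hn.2.2
    have := h (equivDom hn x)
    have h2 : 0 ≤ δ * ‖(equivDom hn x : X)‖ ^ 2 := by positivity
    rw [𝒮.diag, inner_self_eq_norm_sq_to_K]
    simp [← Complex.ofReal_pow]
    linarith
  add_left x y z := by
    simp only [map_add, 𝒮.add_right, Submodule.coe_add, inner_add_left]; ring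
  smul_left x z r := by
    simp only [map_smul, 𝒮.smul_right, Submodule.coe_smul, inner_smul_left]; ring
  definite x h0 := by
    obtain ⟨δ, hδ, h⟩ := hn.2.2
    have h1 := h (equivDom hn x)
    change (ε : ℂ) * polarForm 𝒮.toFun (equivDom hn x) (equivDom hn x)
      + (c : ℂ) * inner ℂ (equivDom hn x : X) (equivDom hn x : X) = 0 at h0
    rw [𝒮.diag, inner_self_eq_norm_sq_to_K] at h0
    have h2 : ε * 𝒮.toFun (equivDom hn x) + c * ‖(equivDom hn x : X)‖ ^ 2 = 0 := by
      have h5 := congrArg Complex.re h0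
      simpa [← Complex.ofReal_pow] using h5
    have h3 : ‖(equivDom hn x : X)‖ ^ 2 ≤ 0 := by
      rw [h2] at h1
      by_contra hc
      have := mul_pos hδ (not_le.1 hc)
      linarith
    have h4 : ‖(equivDom hn x : X)‖ = 0 := by nlinarith [norm_nonneg (equivDom hn x : X)]
    exact Subtype.ext (norm_eq_zero.1 h4)

instance : NormedAddCommGroup (𝒮.FormSpace hn) := (core hn).toNormedAddCommGroup

instance : InnerProductSpace ℂ (𝒮.FormSpace hn) := InnerProductSpace.ofCore (core hn).toCore

theorem norm_sq (x : 𝒮.FormSpace hn) :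
    ‖x‖ ^ 2 = ε * 𝒮.toFun (equivDom hn x) + c * ‖(equivDom hn x : X)‖ ^ 2 := by
  have h : inner ℂ x x = (ε : ℂ) * polarForm 𝒮.toFun (equivDom hn x) (equivDom hn x)
    + (c : ℂ) * inner ℂ (equivDom hn x : X) (equivDom hn x : X) := rfl
  rw [𝒮.diag, inner_self_eq_norm_sq_to_K, inner_self_eq_norm_sq_to_K] at h
  have h2 := congrArg Complex.re h
  simpa [← Complex.ofReal_pow] using h2

end FormSpace

end RealQuadraticForm

namespace SystemNode

variable {X : Type uX} {U : Type uU} {Y : Type uY}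
  [NormedAddCommGroup X] [InnerProductSpace ℂ X]
  [NormedAddCommGroup U] [InnerProductSpace ℂ U]
  [NormedAddCommGroup Y] [InnerProductSpace ℂ Y] (𝔖 : SystemNode X U Y)

/-- Dissipativity with respect to the supply rate `s` and the storage function `𝒮`. -/
def IsDissipative (s : Y → U → ℝ) (𝒮 : RealQuadraticForm X) : Prop :=
  ∀ (T : ℝ), 0 < T → ∀ (x : ℝ → X) (u : ℝ → U) (y : ℝ → Y), 𝔖.IsClassicalTrajectory T x u y →
    ∃ (h0 : x 0 ∈ 𝒮.dom) (hT : x T ∈ 𝒮.dom),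
      0 ≤ 𝒮.toFun ⟨x T, hT⟩ - 𝒮.toFun ⟨x 0, h0⟩ + ∫ t in (0 : ℝ)..T, s (y t) (u t)

/-- For `V ⊆ dom 𝒮` and `(x, u) ∈ W`, the number
`2 Re ⟨P̃ x, A&B (x, u)⟩ + s (C&D (x, u), u)`, with the pairing of an anti-linear functional and a
vector. -/
def dissipationForm (s : Y → U → ℝ) {𝒮 : RealQuadraticForm X} {ε c : ℝ}
    {hn : 𝒮.IsNormShift ε c} (Ptilde : 𝒮.FormSpace hn →L[ℂ] (𝒮.FormSpace hn →L⋆[ℂ] ℂ))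
    (hV : 𝔖.V ≤ 𝒮.dom) (w : 𝔖.W) : ℝ :=
  2 * (Ptilde
      ((RealQuadraticForm.FormSpace.equivDom hn).symm
        ⟨𝔖.stateOf (𝔖.ofW w), hV (𝔖.stateOf_mem_V _)⟩)
      ((RealQuadraticForm.FormSpace.equivDom hn).symm
        ⟨𝔖.applyAB (𝔖.ofW w), hV (𝔖.applyAB_mem_V w)⟩)).re
    + s (𝔖.CD (𝔖.ofW w)) (𝔖.inputOf (𝔖.ofW w))

end SystemNode

end

noncomputable section

/-! Formally, (∗) is the time derivative of the dissipation inequality. The difficulty is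
regularity: along a classical trajectory `x'` is only continuous in `X`, while (∗) needs `x'` in
`V`. The link between the two is `formState`: if `V ⊆ dom 𝒮`, the closed graph theorem makes the
state map from `dom (A&B)` to `dom 𝒮` bounded, so `𝒮` is continuous along continuous paths in `dom
(A&B)` and differentiable along differentiable ones. (i) ⇒ (iii): every `v` in `dom (A&B)` starts a
constant-input trajectory built from the semigroup, hence `V ⊆ dom 𝒮`. For `w` in `W`, some `v` has
state `A&B w`; integrating the trajectory of `v` and adding `w` gives a trajectory that is
differentiable in `dom (A&B)`, and the inequality can be differentiated at `T = 0`. (iii) ⇒ (i):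
averages of a trajectory over `[t, t + h]` lie in `W`, because `A&B` turns them into difference
quotients of the state. Integrate (∗) along the averages and let `h → 0`. (ii) ⇔ (iii) is continuity
of the dissipation form on `W`. (iii) ⇔ (iv) holds because that form is the diagonal of a Hermitian
form; a nonnegative one is a squared seminorm, and `Z` is the Hilbert completion. -/

theorem hasDerivAt_integral_of_continuous {E : Type*} [NormedAddCommGroup E] [NormedSpace ℝ E]
    [CompleteSpace E] {f : ℝ → E} (hf : Continuous f) (a t : ℝ) :
    HasDerivAt (fun t => ∫ s in a..t, f s) (f t) t :=
  intervalIntegral.integral_hasDerivAt_right (hf.intervalIntegrable _ _)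
    (hf.stronglyMeasurableAtFilter _ _) hf.continuousAt

/-! ### Strongly continuous semigroups -/

namespace IsC0Semigroup

variable {X : Type*} [NormedAddCommGroup X] [NormedSpace ℂ X] [CompleteSpace X]
  {T : ℝ≥0 → X →L[ℂ] X}

/-- Otherwise the norms blow up along some `t n → 0`; orbits converge there, hence are bounded,
which contradicts Banach–Steinhaus. -/
theorem exists_bound_near_zero (hT : IsC0Semigroup T) :
    ∃ δ : ℝ≥0, 0 < δ ∧ ∃ M : ℝ, 1 ≤ M ∧ ∀ t ≤ δ, ‖T t‖ ≤ M := by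
  by_contra! hcon
  have hn : ∀ n : ℕ, ∃ t : ℝ≥0, t ≤ 1 / ((n : ℝ≥0) + 1) ∧ (n : ℝ) + 1 < ‖T t‖ := fun n => by
    obtain ⟨t, ht, h⟩ := hcon (1 / ((n : ℝ≥0) + 1)) (by positivity) ((n : ℝ) + 1) (by simp)
    exact ⟨t, ht, h⟩
  choose t ht hbig using hn
  have ht0 : Tendsto t atTop (𝓝 0) :=
    tendsto_of_tendsto_of_tendsto_of_le_of_le tendsto_const_nhds
      tendsto_one_div_add_atTop_nhds_zero_nat (fun _ => zero_le) ht
  obtain ⟨C, hC⟩ := banach_steinhaus (g := fun n => T (t n)) fun x => by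
    obtain ⟨C, hC⟩ := (Metric.isBounded_range_of_tendsto _
      ((hT.tendsto_zero x).comp ht0)).exists_norm_le
    exact ⟨C, fun n => hC _ ⟨n, rfl⟩⟩
  obtain ⟨n, hn⟩ := exists_nat_gt C
  linarith [hbig n, hC n]

/-- Finitely many steps of length at most `δ` cover `[0, b]`, and the semigroup law multiplies their
bounds. -/
theorem exists_bound (hT : IsC0Semigroup T) (b : ℝ≥0) :
    ∃ M : ℝ, 0 ≤ M ∧ ∀ t ≤ b, ‖T t‖ ≤ M := by
  obtain ⟨δ, hδ, M, hM, hb⟩ := hT.exists_bound_near_zero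
  have key : ∀ n : ℕ, ∀ t : ℝ≥0, t ≤ n * δ → ‖T t‖ ≤ M ^ (n + 1) := by
    intro n
    induction n with
    | zero => intro t ht; simpa using hb t (by simp at ht; simp [ht])
    | succ n ih =>
      intro t ht
      have hsplit : t = min t δ + (t - δ) := by
        rcases le_total t δ with h | h
        · rw [min_eq_left h, tsub_eq_zero_of_le h, add_zero]
        · rw [min_eq_right h, add_tsub_cancel_of_le h]
      rw [hsplit, hT.map_add, pow_succ']
      refine (ContinuousLinearMap.opNorm_comp_le _ _).trans ?_
      refine mul_le_mul (hb _ (min_le_right _ _)) (ih _ ?_) (norm_nonneg _) (by linarith)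
      rw [tsub_le_iff_right]
      refine ht.trans (le_of_eq ?_)
      push_cast; ring
  obtain ⟨n, hn⟩ := exists_nat_ge (b / δ)
  refine ⟨M ^ (n + 1), by positivity, fun t ht => key n t (ht.trans ?_)⟩
  rwa [div_le_iff₀ hδ] at hn

/-- Factoring out `T` at the smaller of the two times leaves `T d x - x` with `d = |s - t₀|`. The
local bound is what gives continuity from the left. -/
theorem continuous_orbit (hT : IsC0Semigroup T) (x : X) : Continuous fun t => T t x := by
  rw [continuous_iff_continuousAt]
  intro t₀
  obtain ⟨M, hM, hb⟩ := hT.exists_bound (t₀ + 1)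
  have hd : Tendsto (fun s : ℝ≥0 => nndist s t₀) (𝓝 t₀) (𝓝 0) := by
    have : Continuous fun s : ℝ≥0 => nndist s t₀ := by fun_prop
    simpa using this.tendsto t₀
  have hlim : Tendsto (fun s : ℝ≥0 => M * ‖T (nndist s t₀) x - x‖) (𝓝 t₀) (𝓝 0) := by
    have h1 := (((hT.tendsto_zero x).comp hd).sub_const x).norm.const_mul M
    simpa using h1
  rw [ContinuousAt, tendsto_iff_norm_sub_tendsto_zero]
  refine squeeze_zero' (Eventually.of_forall fun _ => norm_nonneg _) ?_ hlim
  filter_upwards [Iic_mem_nhds (show t₀ < t₀ + 1 by simp)] with s hs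
  have aux : ∀ a d : ℝ≥0, a ≤ t₀ + 1 → ‖T (a + d) x - T a x‖ ≤ M * ‖T d x - x‖ := by
    intro a d ha
    rw [hT.map_add, ContinuousLinearMap.comp_apply, ← map_sub]
    exact (T a).le_of_opNorm_le (hb a ha) _
  rcases le_total t₀ s with h | h
  · have h2 : s = t₀ + nndist s t₀ := by
      ext
      have : (t₀ : ℝ) ≤ s := h
      rw [NNReal.coe_add, coe_nndist, NNReal.dist_eq, abs_of_nonneg (by linarith)]; ring
    have := aux t₀ (nndist s t₀) (by simp)
    rwa [← h2] at this
  · have h2 : t₀ = s + nndist s t₀ := by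
      ext
      have : (s : ℝ) ≤ t₀ := h
      rw [NNReal.coe_add, coe_nndist, NNReal.dist_eq, abs_of_nonpos (by linarith)]; ring
    have := aux s (nndist s t₀) hs
    rwa [← h2, norm_sub_rev] at this

theorem continuous_orbit_toNNReal (hT : IsC0Semigroup T) (x : X) :
    Continuous fun t : ℝ => T t.toNNReal x :=
  (hT.continuous_orbit x).comp continuous_real_toNNReal

/-- With `F` the primitive of the orbit, `T h (F t) = F (t + h) - F h`; so the generator's quotient
is the difference quotient at `0` of `h ↦ F (t + h) - F h`. -/
theorem integral_mem_graph (hT : IsC0Semigroup T) {A : X →ₗ.[ℂ] X} (hA : IsGeneratorOf A T)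
    (g : X) (t : ℝ≥0) :
    (∫ s in (0 : ℝ)..t, T s.toNNReal g, T t g - g) ∈ A.graph := by
  rw [hA]
  -- `toNNReal` freezes the orbit at `g` for negative times, so `φ` is continuous on `ℝ` and `F` has
  -- two-sided derivatives.
  set φ : ℝ → X := fun s => T s.toNNReal g with hφ
  have hc : Continuous φ := hT.continuous_orbit_toNNReal g
  set F : ℝ → X := fun r => ∫ s in (0 : ℝ)..r, φ s with hF
  have hFd : ∀ r, HasDerivAt F (φ r) r := hasDerivAt_integral_of_continuous hc 0
  have hFd' : HasDerivAt (fun h : ℝ => F (t + h) - F h) (φ t - φ 0) 0 := by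
    refine HasDerivAt.sub ?_ (hFd 0)
    have := (hFd ((t : ℝ) + 0)).comp_const_add (t : ℝ) 0
    simpa using this
  have hslope := (hasDerivAt_iff_tendsto_slope_zero.1 hFd').mono_left
    (nhdsWithin_mono (0 : ℝ) (t := {0}ᶜ) (s := Ioi 0) fun x hx => ne_of_gt hx)
  have hcoe : Tendsto (fun h : ℝ≥0 => (h : ℝ)) (𝓝[>] 0) (𝓝[>] 0) := by
    refine tendsto_nhdsWithin_iff.2 ⟨?_, ?_⟩
    · exact (NNReal.continuous_coe.tendsto' 0 0 rfl).mono_left nhdsWithin_le_nhds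
    · filter_upwards [self_mem_nhdsWithin] with h hh using NNReal.coe_pos.2 hh
  have hlim := hslope.comp hcoe
  have e1 : φ t - φ 0 = T t g - g := by simp [hφ, hT.map_zero]
  rw [e1] at hlim
  refine hlim.congr fun h => ?_
  have h0 : F 0 = 0 := by simp [hF]
  have hTh : T h (F t) = F (t + h) - F h := by
    simp only [hF]
    rw [← ContinuousLinearMap.intervalIntegral_comp_comm _ (hc.intervalIntegrable _ _),
      intervalIntegral.integral_interval_sub_left (hc.intervalIntegrable _ _)
        (hc.intervalIntegrable _ _)]
    have h1 : ∫ s in (0 : ℝ)..t, T h (φ s) = ∫ s in (0 : ℝ)..t, φ (s + h) := by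
      refine intervalIntegral.integral_congr fun s hs => ?_
      rw [uIcc_of_le (NNReal.coe_nonneg t)] at hs
      simp only [hφ]
      rw [Real.toNNReal_add hs.1 (NNReal.coe_nonneg h), add_comm, hT.map_add, Real.toNNReal_coe]
      rfl
    rw [h1, intervalIntegral.integral_comp_add_right]
    simp
  simp only [Function.comp_apply, zero_add, add_zero, h0, sub_zero]
  rw [hTh, ← Complex.ofReal_inv, Complex.coe_smul]

end IsC0Semigroup

/-! ### Hilbert spaces from semi-inner products -/

/-- A positive semidefinite sesquilinear form is the pullback of the inner product of a Hilbert
space under a linear map with dense range. -/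
theorem exists_linear_hilbert_factorization {E : Type uX} [AddCommGroup E] [Module ℂ E]
    (core : PreInnerProductSpace.Core ℂ E) :
    ∃ (Z : Type uX) (_ : NormedAddCommGroup Z) (_ : InnerProductSpace ℂ Z) (_ : CompleteSpace Z)
      (k : E →ₗ[ℂ] Z), DenseRange k ∧ ∀ w, (core.inner w w).re = ‖k w‖ ^ 2 := by
  let : SeminormedAddCommGroup E :=
    InnerProductSpace.Core.toSeminormedAddCommGroup (𝕜 := ℂ) (c := core)
  let : InnerProductSpace ℂ E := InnerProductSpace.ofCore core
  -- The form may be degenerate, so `E` is only seminormed; the completion also identifies vectors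
  -- at distance zero.
  refine ⟨UniformSpace.Completion E, inferInstance, inferInstance, inferInstance,
    (UniformSpace.Completion.toComplₗᵢ (𝕜 := ℂ) (E := E)).toLinearMap,
    UniformSpace.Completion.denseRange_coe, fun w => ?_⟩
  have h1 : ‖(UniformSpace.Completion.toComplₗᵢ (𝕜 := ℂ) (E := E)).toLinearMap w‖ = ‖w‖ :=
    UniformSpace.Completion.norm_coe w
  rw [h1]
  exact (norm_sq_eq_re_inner (𝕜 := ℂ) w).symm

/-- A positive semidefinite sesquilinear form that is continuous on the diagonal factors through a
bounded map with dense range into a Hilbert space. -/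
theorem exists_hilbert_factorization {E : Type uX} [NormedAddCommGroup E] [NormedSpace ℂ E]
    (core : PreInnerProductSpace.Core ℂ E)
    (hcont : Continuous fun w : E => (core.inner w w).re) :
    ∃ (Z : Type uX) (_ : NormedAddCommGroup Z) (_ : InnerProductSpace ℂ Z) (_ : CompleteSpace Z)
      (K : E →L[ℂ] Z), DenseRange K ∧ ∀ w, (core.inner w w).re = ‖K w‖ ^ 2 := by
  obtain ⟨Z, i1, i2, i3, k, hd, hk⟩ := exists_linear_hilbert_factorization core
  have hkc : Continuous k := by
    refine continuous_of_continuousAt_zero k ?_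
    rw [ContinuousAt, map_zero, tendsto_zero_iff_norm_tendsto_zero]
    have h1 : Tendsto (fun w => √((core.inner w w).re)) (𝓝 0) (𝓝 0) := by
      refine (Real.continuous_sqrt.comp hcont).tendsto' 0 0 ?_
      simp [hk]
    refine h1.congr fun w => ?_
    rw [hk, Real.sqrt_sq (norm_nonneg _)]
  exact ⟨Z, i1, i2, i3, ⟨k, hkc⟩, hd, hk⟩

/-! ### Graph norm and continuity -/

namespace GraphSpace

variable {E F : Type*} [NormedAddCommGroup E] [InnerProductSpace ℂ E]
  [NormedAddCommGroup F] [InnerProductSpace ℂ F] (A : E →ₗ.[ℂ] F)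

theorem isometry_toGraph : Isometry (toGraph A) :=
  AddMonoidHomClass.isometry_of_norm _ fun _ => rfl

theorem completeSpace [CompleteSpace E] [CompleteSpace F] (hA : A.IsClosed) :
    CompleteSpace (GraphSpace A) := by
  rw [completeSpace_iff_isComplete_range (isometry_toGraph A).isUniformInducing]
  refine IsClosed.isComplete ?_
  have hrange : range (toGraph A) =
      (fun p : WithLp 2 (E × F) => (p.fst, p.snd)) ⁻¹' (A.graph : Set (E × F)) := by
    ext p
    simp only [mem_range, mem_preimage, SetLike.mem_coe, LinearPMap.mem_graph_iff]
    constructor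
    · rintro ⟨v, rfl⟩
      exact ⟨v, rfl, rfl⟩
    · rintro ⟨v, h1, h2⟩
      exact ⟨v, WithLp.ofLp_injective 2 (Prod.ext h1 h2)⟩
  rw [hrange]
  exact IsClosed.preimage (by fun_prop) hA

end GraphSpace

/-! ### Classical trajectories as continuous paths in `dom (A&B)` -/

namespace SystemNode

variable {X : Type uX} {U : Type uU} {Y : Type uY}
  [NormedAddCommGroup X] [InnerProductSpace ℂ X]
  [NormedAddCommGroup U] [InnerProductSpace ℂ U]
  [NormedAddCommGroup Y] [InnerProductSpace ℂ Y] (𝔖 : SystemNode X U Y)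

theorem graph_norm_sq (v : GraphSpace 𝔖.AB) :
    ‖v‖ ^ 2 = ‖𝔖.stateOf v‖ ^ 2 + ‖𝔖.inputOf v‖ ^ 2 + ‖𝔖.applyAB v‖ ^ 2 := by
  have h1 := GraphSpace.norm_sq 𝔖.AB v
  rw [WithLp.prod_norm_sq_eq_of_L2] at h1
  exact h1

theorem graph_ext {v w : GraphSpace 𝔖.AB} (hs : 𝔖.stateOf v = 𝔖.stateOf w)
    (hi : 𝔖.inputOf v = 𝔖.inputOf w) : v = w :=
   Subtype.ext (WithLp.ofLp_injective 2 (Prod.ext hs hi))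

/-- The state component as a bounded operator on `dom (A&B)`. -/
def stateL : GraphSpace 𝔖.AB →L[ℂ] X :=
  𝔖.stateOf.mkContinuous 1 fun v => by simpa using 𝔖.norm_stateOf_le v

/-- The input component as a bounded operator on `dom (A&B)`. -/
def inputL : GraphSpace 𝔖.AB →L[ℂ] U :=
  𝔖.inputOf.mkContinuous 1 fun v => by
    rw [one_mul]
    refine le_of_sq_le_sq ?_ (norm_nonneg v)
    rw [𝔖.graph_norm_sq]; nlinarith [sq_nonneg ‖𝔖.stateOf v‖, sq_nonneg ‖𝔖.applyAB v‖]

/-- `A&B` as a bounded operator on its domain. -/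
def abL : GraphSpace 𝔖.AB →L[ℂ] X :=
  𝔖.applyAB.mkContinuous 1 fun v => by
    rw [one_mul]
    refine le_of_sq_le_sq ?_ (norm_nonneg v)
    rw [𝔖.graph_norm_sq]; nlinarith [sq_nonneg ‖𝔖.stateOf v‖, sq_nonneg ‖𝔖.inputOf v‖]

@[simp] theorem stateL_apply (v : GraphSpace 𝔖.AB) : 𝔖.stateL v = 𝔖.stateOf v := rfl
@[simp] theorem abL_apply (v : GraphSpace 𝔖.AB) : 𝔖.abL v = 𝔖.applyAB v := rfl

/-- Continuity into `dom (A&B)` can thus be tested on state, input and `A&B` separately. The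
constant `2` dominates `√3`, from three components under the maximum norm. -/
theorem isInducing_components : Topology.IsInducing
    fun v : GraphSpace 𝔖.AB => (𝔖.stateOf v, 𝔖.inputOf v, 𝔖.applyAB v) := by
  let f : GraphSpace 𝔖.AB →L[ℂ] X × U × X := 𝔖.stateL.prod (𝔖.inputL.prod 𝔖.abL)
  have hf : AntilipschitzWith 2 f := f.antilipschitz_of_bound fun v => by
    have h0 : 0 ≤ ‖f v‖ := norm_nonneg _
    have h1 : ‖𝔖.stateOf v‖ ≤ ‖f v‖ := norm_fst_le (f v)
    have h2 : ‖𝔖.inputOf v‖ ≤ ‖f v‖ := (norm_fst_le (f v).2).trans (norm_snd_le (f v))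
    have h3 : ‖𝔖.applyAB v‖ ≤ ‖f v‖ := (norm_snd_le (f v).2).trans (norm_snd_le (f v))
    refine le_of_sq_le_sq ?_ (by positivity)
    rw [𝔖.graph_norm_sq, NNReal.coe_ofNat]
    nlinarith [norm_nonneg (𝔖.stateOf v), norm_nonneg (𝔖.inputOf v), norm_nonneg (𝔖.applyAB v)]
  exact (hf.isUniformInducing f.uniformContinuous).isInducing


theorem mem_domain (v : GraphSpace 𝔖.AB) :
    WithLp.toLp 2 (𝔖.stateOf v, 𝔖.inputOf v) ∈ 𝔖.AB.domain :=
  (GraphSpace.equivDomain 𝔖.AB v).2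

/-- The element `(x, 0)` of `dom (A&B)` for `x` in the domain of the main operator. -/
theorem exists_of_mem_graph_mainOperator {x y : X} (h : (x, y) ∈ (mainOperator 𝔖.AB).graph) :
    ∃ v : GraphSpace 𝔖.AB, 𝔖.stateOf v = x ∧ 𝔖.inputOf v = 0 ∧ 𝔖.applyAB v = y := by
  obtain ⟨z, hz, hy⟩ := (LinearPMap.mem_graph_iff _).1 h
  refine ⟨𝔖.pair z 0 z.2, hz, rfl, hy⟩

/-- Continuity in the graph norm holds because the `A&B` component is the derivative of a `C¹`
state. -/
theorem IsClassicalTrajectory.exists_graph_path {T : ℝ} (hT : 0 < T)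
    {x : ℝ → X} {u : ℝ → U} {y : ℝ → Y}
    (h : 𝔖.IsClassicalTrajectory T x u y) :
    ∃ z : ℝ → GraphSpace 𝔖.AB, ContinuousOn z (Icc 0 T) ∧ ∀ t ∈ Icc 0 T,
      𝔖.stateOf (z t) = x t ∧ 𝔖.inputOf (z t) = u t ∧ 𝔖.CD (z t) = y t ∧
        HasDerivWithinAt x (𝔖.applyAB (z t)) (Icc 0 T) t := by
  classical
  have hdom : ∀ t ∈ Icc 0 T, WithLp.toLp 2 (x t, u t) ∈ 𝔖.AB.domain := fun t ht =>
    (h.eqn t ht).1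
  let z : ℝ → GraphSpace 𝔖.AB := fun t =>
    if ht : t ∈ Icc 0 T then 𝔖.pair (x t) (u t) (hdom t ht) else 0
  have hz : ∀ t (ht : t ∈ Icc 0 T), z t = 𝔖.pair (x t) (u t) (hdom t ht) := fun t ht =>
    dif_pos ht
  have hd : ∀ t ∈ Icc 0 T, HasDerivWithinAt x (𝔖.applyAB (z t)) (Icc 0 T) t := fun t ht => by
    rw [hz t ht]; exact (h.eqn t ht).2.1
  refine ⟨z, ?_, fun t ht => ⟨by rw [hz t ht]; rfl, by rw [hz t ht]; rfl, ?_, hd t ht⟩⟩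
  · rw [𝔖.isInducing_components.continuousOn_iff]
    have hx' : ContinuousOn (derivWithin x (Icc 0 T)) (Icc 0 T) :=
      h.state.continuousOn_derivWithin (uniqueDiffOn_Icc hT) le_rfl
    refine (h.state.continuousOn.prodMk (h.input.prodMk hx')).congr fun t ht => ?_
    have := (hd t ht).derivWithin (uniqueDiffOn_Icc hT t ht)
    simp only [Function.comp_apply, this]
    rw [hz t ht]; rfl
  · rw [hz t ht]; exact (h.eqn t ht).2.2.symm

variable [CompleteSpace X]

/-- Trajectory with constant input starting at a prescribed point of `dom (A&B)`. -/
theorem exists_constant_input_trajectory (v : GraphSpace 𝔖.AB) :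
    ∃ ζ : ℝ → GraphSpace 𝔖.AB, Continuous ζ ∧ ζ 0 = v ∧ (∀ t, 𝔖.inputOf (ζ t) = 𝔖.inputOf v) ∧
      ∃ φ : ℝ → X, Continuous φ ∧ (∀ t, 0 ≤ t → 𝔖.applyAB (ζ t) = φ t) ∧
        ∀ t, 0 ≤ t → 𝔖.stateOf (ζ t) = 𝔖.stateOf v + ∫ s in (0 : ℝ)..t, φ s := by
  obtain ⟨T, hT, hA⟩ := 𝔖.generates
  set g := 𝔖.applyAB v with hg
  -- `ω t = (∫₀ᵗ T s g ds, 0)` and `A&B (ω t) = T t g - g`, so `A&B (v + ω t) = T t g`, the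
  -- derivative of the state of `v + ω t`.
  choose ω hω1 hω2 hω3 using fun t : ℝ≥0 =>
    𝔖.exists_of_mem_graph_mainOperator (hT.integral_mem_graph hA g t)
  refine ⟨fun t => v + ω t.toNNReal, ?_, ?_, ?_, fun t => T t.toNNReal g,
    hT.continuous_orbit_toNNReal g, ?_, ?_⟩
  · rw [𝔖.isInducing_components.continuous_iff]
    have h1 : Continuous fun t : ℝ =>
        𝔖.stateOf v + ∫ s in (0 : ℝ)..(t.toNNReal : ℝ), T s.toNNReal g := by
      refine continuous_const.add ?_
      exact (intervalIntegral.continuous_primitive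
        (fun a b => (hT.continuous_orbit_toNNReal g).intervalIntegrable a b) 0).comp
        (NNReal.continuous_coe.comp continuous_real_toNNReal)
    have h2 : Continuous fun t : ℝ => T t.toNNReal g := hT.continuous_orbit_toNNReal g
    refine (h1.prodMk ((continuous_const (y := 𝔖.inputOf v)).prodMk h2)).congr fun t => ?_
    simp [hω1, hω2, hω3, hg]
  · refine 𝔖.graph_ext ?_ ?_ <;> simp [hω1, hω2]
  · intro t; simp [hω2]
  · intro t ht; simp [hω3, hg]
  · intro t ht; simp [hω1, ht]

end SystemNode

/-! ### The form domain -/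

theorem continuous_supplyRate {U : Type uU} {Y : Type uY}
    [NormedAddCommGroup U] [InnerProductSpace ℂ U] [CompleteSpace U]
    [NormedAddCommGroup Y] [InnerProductSpace ℂ Y] [CompleteSpace Y]
    (Q : Y →L[ℂ] Y) (S : U →L[ℂ] Y) (R : U →L[ℂ] U) :
    Continuous fun p : Y × U => supplyRate Q S R p.1 p.2 := by
  unfold supplyRate
  fun_prop

namespace RealQuadraticForm

namespace FormSpace

variable {X : Type uX} [NormedAddCommGroup X] [InnerProductSpace ℂ X] {𝒮 : RealQuadraticForm X}
  {ε c : ℝ} (hn : 𝒮.IsNormShift ε c)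

include hn in
theorem _root_.RealQuadraticForm.IsNormShift.mul_self : ε * ε = 1 := by
  rcases hn.1 with h | h <;> simp [h]

/-- The embedding of the form domain into the state space. -/
def embed : 𝒮.FormSpace hn →L[ℂ] X :=
  (𝒮.dom.subtype ∘ₗ (equivDom hn).toLinearMap).mkContinuousOfExistsBound <| by
    obtain ⟨δ, hδ, h⟩ := hn.2.2
    refine ⟨√δ⁻¹, fun x => le_of_sq_le_sq ?_ (by positivity)⟩
    rw [mul_pow, Real.sq_sqrt (by positivity), norm_sq, inv_mul_eq_div, le_div_iff₀ hδ, mul_comm]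
    exact h _

theorem embed_injective : Function.Injective (embed hn) := fun _ _ h => Subtype.ext h

/-- Since `ε² = 1`, the definition of the inner product can be solved for `h`. All continuity and
differentiability of `𝒮` in the form norm comes from this, whichever the sign `ε`. -/
theorem polarForm_eq (x z : 𝒮.FormSpace hn) :
    polarForm 𝒮.toFun (equivDom hn x) (equivDom hn z) =
      ε * (inner ℂ z x - c * inner ℂ (embed hn z) (embed hn x)) := by
  have h : inner ℂ z x = (ε : ℂ) * polarForm 𝒮.toFun (equivDom hn x) (equivDom hn z)
    + (c : ℂ) * inner ℂ (embed hn z) (embed hn x) := rfl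
  have hε : (ε : ℂ) * ε = 1 := by exact_mod_cast hn.mul_self
  rw [h, add_sub_cancel_right, ← mul_assoc, hε, one_mul]

theorem continuous_polarForm {α : Type*} [TopologicalSpace α] {f g : α → 𝒮.FormSpace hn}
    (hf : Continuous f) (hg : Continuous g) :
    Continuous fun a => polarForm 𝒮.toFun (equivDom hn (f a)) (equivDom hn (g a)) := by
  simp only [polarForm_eq]
  exact continuous_const.mul ((hg.inner hf).sub (continuous_const.mul
    (((embed hn).continuous.comp hg).inner ((embed hn).continuous.comp hf))))

theorem toFun_eq (x : 𝒮.FormSpace hn) :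
    𝒮.toFun (equivDom hn x) = (polarForm 𝒮.toFun (equivDom hn x) (equivDom hn x)).re := by
  rw [𝒮.diag, Complex.ofReal_re]

theorem continuous_toFun : Continuous fun x : 𝒮.FormSpace hn => 𝒮.toFun (equivDom hn x) := by
  simp only [toFun_eq]
  exact Complex.continuous_re.comp (continuous_polarForm hn continuous_id continuous_id)

theorem hasDerivAt_toFun {v : ℝ → 𝒮.FormSpace hn} {v' : 𝒮.FormSpace hn} {t : ℝ}
    (hv : HasDerivAt v v' t) :
    HasDerivAt (fun s => 𝒮.toFun (equivDom hn (v s)))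
      (2 * (polarForm 𝒮.toFun (equivDom hn v') (equivDom hn (v t))).re) t := by
  simp only [toFun_eq, polarForm_eq]
  have h1 := hv.inner ℂ hv
  have hX : HasDerivAt (fun s => embed hn (v s)) (embed hn v') t :=
    ((embed hn).restrictScalars ℝ).hasFDerivAt.comp_hasDerivAt t hv
  have h2 := (hX.inner ℂ hX).const_mul (c : ℂ)
  have h3 := (Complex.reCLM.hasFDerivAt.comp_hasDerivAt t ((h1.sub h2).const_mul (ε : ℂ)))
  refine h3.congr_deriv ?_
  have e1 : (inner ℂ v' (v t)).re = (inner ℂ (v t) v').re := inner_re_symm (𝕜 := ℂ) v' (v t)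
  have e2 : (inner ℂ (embed hn v') (embed hn (v t))).re =
      (inner ℂ (embed hn (v t)) (embed hn v')).re := inner_re_symm (𝕜 := ℂ) _ _
  simp only [Complex.reCLM_apply, Complex.re_ofReal_mul, Complex.sub_re, Complex.add_re, e1, e2]
  ring

end FormSpace

end RealQuadraticForm

/-! ### The dissipation form on `W` -/

namespace SystemNode

open RealQuadraticForm

variable {X : Type uX} {U : Type uU} {Y : Type uY}
  [NormedAddCommGroup X] [InnerProductSpace ℂ X]
  [NormedAddCommGroup U] [InnerProductSpace ℂ U]
  [NormedAddCommGroup Y] [InnerProductSpace ℂ Y] (𝔖 : SystemNode X U Y)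

theorem norm_equivV_le (x : 𝔖.VSpace) : ‖(𝔖.equivV x : X)‖ ≤ ‖x‖ :=
  VSpace.le_norm 𝔖 x _ fun v hv => hv ▸ 𝔖.norm_stateOf_le v

/-- The bounded inclusion of `W` into `dom (A&B)`. -/
def ofWL : 𝔖.W →L[ℂ] GraphSpace 𝔖.AB :=
  𝔖.ofW.mkContinuous 1 fun w => by
    rw [one_mul]
    refine le_of_sq_le_sq ?_ (norm_nonneg w)
    rw [𝔖.graph_norm_sq, W.norm_sq]
    gcongr
    exact 𝔖.norm_equivV_le (𝔖.applyABV w)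

/-- `A&B` as a bounded operator from `W` to `V`. -/
def applyABVL : 𝔖.W →L[ℂ] 𝔖.VSpace :=
  𝔖.applyABV.mkContinuous 1 fun w => by
    rw [one_mul]
    refine le_of_sq_le_sq ?_ (norm_nonneg w)
    rw [W.norm_sq]
    nlinarith [sq_nonneg ‖𝔖.stateOf (𝔖.ofW w)‖, sq_nonneg ‖𝔖.inputOf (𝔖.ofW w)‖]

variable [CompleteSpace X] [CompleteSpace U] {𝒮 : RealQuadraticForm X} {ε c : ℝ}
  (hn : 𝒮.IsNormShift ε c) [CompleteSpace (𝒮.FormSpace hn)] (hV : 𝔖.V ≤ 𝒮.dom)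

/-- The state component as a bounded operator from `dom (A&B)` to `dom 𝒮`, when `V ⊆ dom 𝒮`. -/
def formState : GraphSpace 𝔖.AB →L[ℂ] 𝒮.FormSpace hn :=
  ⟨(FormSpace.equivDom hn).symm.toLinearMap ∘ₗ
      𝔖.stateOf.codRestrict 𝒮.dom (fun v => hV (𝔖.stateOf_mem_V v)), by
    have := GraphSpace.completeSpace 𝔖.AB 𝔖.AB_isClosed
    -- Closed graph theorem: both spaces are complete, and limits in `dom 𝒮` are identified after
    -- embedding into `X`, where the state map is already continuous.
    refine LinearMap.continuous_of_seq_closed_graph _ fun a x y hx hy => ?_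
    refine FormSpace.embed_injective hn (tendsto_nhds_unique
      (((FormSpace.embed hn).continuous.tendsto y).comp hy) ?_)
    exact (𝔖.stateL.continuous.tendsto x).comp hx⟩

/-- The bounded inclusion of `V` into `dom 𝒮`. -/
def formV : 𝔖.VSpace →L[ℂ] 𝒮.FormSpace hn :=
  LinearMap.mkContinuous ((FormSpace.equivDom hn).symm.toLinearMap ∘ₗ
      Submodule.inclusion hV ∘ₗ 𝔖.equivV.toLinearMap) ‖𝔖.formState hn hV‖ fun x => by
    -- The infimum defining the `V` norm is compared after dividing by the operator norm, so norm
    -- zero is treated apart.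
    obtain h0 | h0 := (norm_nonneg (𝔖.formState hn hV)).eq_or_lt
    · obtain ⟨v, hv⟩ := (𝔖.equivV x).2
      have h1 : (FormSpace.equivDom hn).symm (Submodule.inclusion hV (𝔖.equivV x)) =
          𝔖.formState hn hV v := FormSpace.embed_injective hn hv.symm
      change ‖(FormSpace.equivDom hn).symm (Submodule.inclusion hV (𝔖.equivV x))‖ ≤ _
      rw [h1, ← h0, zero_mul]
      simpa [← h0] using (𝔖.formState hn hV).le_opNorm v
    · rw [mul_comm, ← div_le_iff₀ h0]
      refine VSpace.le_norm 𝔖 x _ fun v hv => ?_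
      have h1 : (FormSpace.equivDom hn).symm (Submodule.inclusion hV (𝔖.equivV x)) =
          𝔖.formState hn hV v := FormSpace.embed_injective hn hv.symm
      rw [div_le_iff₀ h0, mul_comm]
      change ‖(FormSpace.equivDom hn).symm (Submodule.inclusion hV (𝔖.equivV x))‖ ≤ _
      rw [h1]
      exact (𝔖.formState hn hV).le_opNorm v

variable {hn} in
theorem dissipationForm_eq {Ptilde : 𝒮.FormSpace hn →L[ℂ] (𝒮.FormSpace hn →L⋆[ℂ] ℂ)}
    (hP : ∀ x z : 𝒮.FormSpace hn,
      polarForm 𝒮.toFun (FormSpace.equivDom hn x) (FormSpace.equivDom hn z) = conj (Ptilde z x))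
    (s : Y → U → ℝ) (w : 𝔖.W) :
    𝔖.dissipationForm s Ptilde hV w =
      2 * (polarForm 𝒮.toFun (FormSpace.equivDom hn (𝔖.formV hn hV (𝔖.applyABVL w)))
        (FormSpace.equivDom hn (𝔖.formState hn hV (𝔖.ofWL w)))).re
      + s (𝔖.CD (𝔖.ofWL w)) (𝔖.inputL (𝔖.ofWL w)) := by
  rw [hP, Complex.conj_re]
  rfl

variable [CompleteSpace Y] (Q : Y →L[ℂ] Y) (S : U →L[ℂ] Y) (R : U →L[ℂ] U)

variable {hn} in
-- Extends (∗) from a dense subspace to `W`, and makes the factor `K&L` bounded.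
theorem continuous_dissipationForm
    {Ptilde : 𝒮.FormSpace hn →L[ℂ] (𝒮.FormSpace hn →L⋆[ℂ] ℂ)}
    (hP : ∀ x z : 𝒮.FormSpace hn,
      polarForm 𝒮.toFun (FormSpace.equivDom hn x) (FormSpace.equivDom hn z) = conj (Ptilde z x)) :
    Continuous fun w => 𝔖.dissipationForm (supplyRate Q S R) Ptilde hV w := by
  simp only [𝔖.dissipationForm_eq hV hP]
  refine Continuous.add (continuous_const.mul (Complex.continuous_re.comp
    (FormSpace.continuous_polarForm hn (by fun_prop) (by fun_prop)))) ?_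
  exact (continuous_supplyRate Q S R).comp (f := fun w : 𝔖.W =>
    (𝔖.CD (𝔖.ofWL w), 𝔖.inputL (𝔖.ofWL w))) (by fun_prop)

/-- The sesquilinear form on `W` whose diagonal is the dissipation form. -/
def dissipationInner (w₁ w₂ : 𝔖.W) : ℂ :=
  polarForm 𝒮.toFun (FormSpace.equivDom hn (𝔖.formV hn hV (𝔖.applyABVL w₂)))
      (FormSpace.equivDom hn (𝔖.formState hn hV (𝔖.ofWL w₁)))
    + conj (polarForm 𝒮.toFun (FormSpace.equivDom hn (𝔖.formV hn hV (𝔖.applyABVL w₁)))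
      (FormSpace.equivDom hn (𝔖.formState hn hV (𝔖.ofWL w₂))))
    + (inner ℂ (𝔖.CD (𝔖.ofWL w₁)) (Q (𝔖.CD (𝔖.ofWL w₂)) + S (𝔖.inputL (𝔖.ofWL w₂)))
      + inner ℂ (𝔖.inputL (𝔖.ofWL w₁)) (ContinuousLinearMap.adjoint S (𝔖.CD (𝔖.ofWL w₂))
        + R (𝔖.inputL (𝔖.ofWL w₂))))

variable {hn} in
theorem re_dissipationInner_self {Ptilde : 𝒮.FormSpace hn →L[ℂ] (𝒮.FormSpace hn →L⋆[ℂ] ℂ)}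
    (hP : ∀ x z : 𝒮.FormSpace hn,
      polarForm 𝒮.toFun (FormSpace.equivDom hn x) (FormSpace.equivDom hn z) = conj (Ptilde z x))
    (w : 𝔖.W) :
    (𝔖.dissipationInner hn hV Q S R w w).re =
      𝔖.dissipationForm (supplyRate Q S R) Ptilde hV w := by
  rw [𝔖.dissipationForm_eq hV hP, supplyRate, dissipationInner]
  simp only [Complex.add_re, Complex.conj_re]
  rw [← inner_conj_symm (𝔖.CD (𝔖.ofWL w)), ← inner_conj_symm (𝔖.inputL (𝔖.ofWL w)),
    Complex.conj_re, Complex.conj_re]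
  ring

variable {hn} {Q R} in
/-- When the dissipation form is nonnegative, it comes from a semi-inner product on `W`. -/
@[reducible] def dissipationCore {Ptilde : 𝒮.FormSpace hn →L[ℂ] (𝒮.FormSpace hn →L⋆[ℂ] ℂ)}
    (hP : ∀ x z : 𝒮.FormSpace hn,
      polarForm 𝒮.toFun (FormSpace.equivDom hn x) (FormSpace.equivDom hn z) = conj (Ptilde z x))
    (hQ : IsSelfAdjoint Q) (hR : IsSelfAdjoint R)
    (hpos : ∀ w : 𝔖.W, 0 ≤ 𝔖.dissipationForm (supplyRate Q S R) Ptilde hV w) :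
    PreInnerProductSpace.Core ℂ 𝔖.W where
  inner := 𝔖.dissipationInner hn hV Q S R
  conj_inner_symm w₁ w₂ := by
    -- Self-adjointness of `Q` and `R` gives Hermitian symmetry; the two cross terms with `S` are
    -- exchanged by the adjoint.
    have h1 := hQ.isSymmetric (𝔖.CD (𝔖.ofWL w₁)) (𝔖.CD (𝔖.ofWL w₂))
    have h2 := hR.isSymmetric (𝔖.inputL (𝔖.ofWL w₁)) (𝔖.inputL (𝔖.ofWL w₂))
    simp only [ContinuousLinearMap.coe_coe] at h1 h2
    simp only [dissipationInner, map_add, Complex.conj_conj, inner_conj_symm,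
      inner_add_right, h1, h2,
      ContinuousLinearMap.adjoint_inner_right]
    ring
  re_inner_nonneg w := by
    have := hpos w
    rwa [← 𝔖.re_dissipationInner_self hV Q S R hP] at this
  add_left w₁ w₂ w₃ := by
    simp only [dissipationInner, map_add, 𝒮.add_left, 𝒮.add_right, inner_add_left]
    ring
  smul_left w₁ w₂ r := by
    simp only [dissipationInner, map_smul, 𝒮.smul_left, 𝒮.smul_right, inner_smul_left, map_mul]
    ring

end SystemNode

/-! ### Dissipation along trajectories -/

theorem nonneg_deriv_of_nonneg_right {f : ℝ → ℝ} {f' : ℝ} (hf : HasDerivAt f f' 0) (h0 : f 0 = 0)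
    (hpos : ∀ t, 0 < t → 0 ≤ f t) : 0 ≤ f' := by
  have hlim := (hasDerivAt_iff_tendsto_slope_zero.1 hf).mono_left
    (nhdsWithin_mono (0 : ℝ) (t := {0}ᶜ) (s := Ioi 0) fun x hx => ne_of_gt hx)
  refine ge_of_tendsto hlim ?_
  filter_upwards [self_mem_nhdsWithin] with t ht
  have ht' : (0 : ℝ) < t := ht
  rw [zero_add, h0, sub_zero, smul_eq_mul]
  exact mul_nonneg (inv_nonneg.2 ht'.le) (hpos t ht')

/-- Forward averages of a path, `t ↦ ∫₀¹ z (t + h σ) dσ`. -/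
def forwardAverage {E : Type*} [NormedAddCommGroup E] [NormedSpace ℝ E] (z : ℝ → E) (h t : ℝ) : E :=
  ∫ σ in (0 : ℝ)..1, z (t + h * σ)

section forwardAverage

variable {E : Type*} [NormedAddCommGroup E] [NormedSpace ℝ E] [CompleteSpace E] {z : ℝ → E}

omit [CompleteSpace E] in
-- Averaging over the fixed interval `[0, 1]` makes joint continuity include `h = 0`, where the
-- average is the path itself.
theorem forwardAverage_continuous (hz : Continuous z) :
    Continuous fun p : ℝ × ℝ => forwardAverage z p.1 p.2 :=
  intervalIntegral.continuous_parametric_intervalIntegral_of_continuous' (by fun_prop) 0 1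

theorem forwardAverage_zero (z : ℝ → E) (t : ℝ) : forwardAverage z 0 t = z t := by
  simp [forwardAverage]

omit [CompleteSpace E] in
theorem forwardAverage_eq {h : ℝ} (hh : h ≠ 0) (t : ℝ) :
    forwardAverage z h t = h⁻¹ • ∫ s in t..t + h, z s := by
  simp [forwardAverage, intervalIntegral.integral_comp_add_mul _ hh]

theorem hasDerivAt_forwardAverage (hz : Continuous z) {h : ℝ} (hh : h ≠ 0) (t : ℝ) :
    HasDerivAt (forwardAverage z h) (h⁻¹ • (z (t + h) - z t)) t := by
  have h1 : forwardAverage z h =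
      fun t => h⁻¹ • ((∫ s in (0 : ℝ)..t + h, z s) - ∫ s in (0 : ℝ)..t, z s) := by
    funext t
    rw [forwardAverage_eq hh, intervalIntegral.integral_interval_sub_left] <;>
      exact hz.intervalIntegrable _ _
  rw [h1]
  exact (((hasDerivAt_integral_of_continuous hz 0 (t + h)).comp_add_const t h).sub
    (hasDerivAt_integral_of_continuous hz 0 t)).const_smul h⁻¹

end forwardAverage

/-! ### From the dissipation inequality to (∗), and back -/

namespace SystemNode

open RealQuadraticForm

variable {X : Type uX} {U : Type uU} {Y : Type uY}
  [NormedAddCommGroup X] [InnerProductSpace ℂ X]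
  [NormedAddCommGroup U] [InnerProductSpace ℂ U]
  [NormedAddCommGroup Y] [InnerProductSpace ℂ Y] (𝔖 : SystemNode X U Y)

theorem isClassicalTrajectory_of_path {T : ℝ} (hT : 0 < T) {z : ℝ → GraphSpace 𝔖.AB}
    (hz : Continuous z) (hd : ∀ t ∈ Icc 0 T,
      HasDerivWithinAt (fun s => 𝔖.stateOf (z s)) (𝔖.applyAB (z t)) (Icc 0 T) t) :
    𝔖.IsClassicalTrajectory T (fun t => 𝔖.stateOf (z t)) (fun t => 𝔖.inputOf (z t))
      (fun t => 𝔖.CD (z t)) where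
  state := by
    rw [contDiffOn_one_iff_derivWithin (uniqueDiffOn_Icc hT)]
    refine ⟨fun t ht => (hd t ht).differentiableWithinAt, ?_⟩
    refine (𝔖.abL.continuous.comp hz).continuousOn.congr fun t ht => ?_
    exact (hd t ht).derivWithin (uniqueDiffOn_Icc hT t ht)
  input := (𝔖.inputL.continuous.comp hz).continuousOn
  output := (𝔖.CD.continuous.comp hz).continuousOn
  eqn t ht := ⟨𝔖.mem_domain (z t), hd t ht, rfl⟩

theorem exists_ofWL_eq {v d : GraphSpace 𝔖.AB} (h : 𝔖.stateOf d = 𝔖.applyAB v) :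
    ∃ w : 𝔖.W, 𝔖.ofWL w = v :=
  ⟨⟨v, d, h⟩, rfl⟩

variable [CompleteSpace X]

/-- Every element of `dom (A&B)` starts a classical trajectory, and dissipativity includes `x 0 ∈
𝒮.dom`. -/
theorem V_le_of_isDissipative {s : Y → U → ℝ} {𝒮 : RealQuadraticForm X}
    (h : 𝔖.IsDissipative s 𝒮) : 𝔖.V ≤ 𝒮.dom := by
  rintro _ ⟨v, rfl⟩
  obtain ⟨ζ, hζ, h0, -, φ, hφ, hAB, hst⟩ := 𝔖.exists_constant_input_trajectory v
  obtain ⟨hdom, -⟩ := h 1 one_pos _ _ _ <|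
    𝔖.isClassicalTrajectory_of_path one_pos hζ fun t ht => by
      rw [hAB t ht.1]
      exact ((hasDerivAt_integral_of_continuous hφ 0 t).const_add _).hasDerivWithinAt.congr
        (fun r hr => hst r hr.1) (hst t ht.1)
  rwa [h0] at hdom

variable [CompleteSpace U] [CompleteSpace Y] (Q : Y →L[ℂ] Y) (S : U →L[ℂ] Y) (R : U →L[ℂ] U)

/-- The supply rate as a function on `dom (A&B)`. -/
def supplyOn (v : GraphSpace 𝔖.AB) : ℝ := supplyRate Q S R (𝔖.CD v) (𝔖.inputOf v)

omit [CompleteSpace X] in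
theorem continuous_supplyOn : Continuous (𝔖.supplyOn Q S R) :=
  (continuous_supplyRate Q S R).comp (𝔖.CD.continuous.prodMk 𝔖.inputL.continuous)

variable {𝒮 : RealQuadraticForm X} {ε c : ℝ}
  (hn : 𝒮.IsNormShift ε c) [CompleteSpace (𝒮.FormSpace hn)] (hV : 𝔖.V ≤ 𝒮.dom)

/-- The storage function as a function on `dom (A&B)`. -/
def storageOn (v : GraphSpace 𝔖.AB) : ℝ :=
  𝒮.toFun (FormSpace.equivDom hn (𝔖.formState hn hV v))

/-- `h (x₁, x₂)` as a function of two elements of `dom (A&B)` with states `x₁`, `x₂`. -/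
def polarOn (v₁ v₂ : GraphSpace 𝔖.AB) : ℂ :=
  polarForm 𝒮.toFun (FormSpace.equivDom hn (𝔖.formState hn hV v₁))
    (FormSpace.equivDom hn (𝔖.formState hn hV v₂))

omit [CompleteSpace Y] in
theorem continuous_storageOn : Continuous (𝔖.storageOn hn hV) :=
  (FormSpace.continuous_toFun hn).comp (𝔖.formState hn hV).continuous

omit [CompleteSpace Y] in
theorem storageOn_eq (v : GraphSpace 𝔖.AB) {x : X} (hx : 𝔖.stateOf v = x) (h : x ∈ 𝒮.dom) :
    𝔖.storageOn hn hV v = 𝒮.toFun ⟨x, h⟩ := by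
  subst hx; rfl

omit [CompleteSpace Y] in
theorem hasDerivAt_storageOn {z : ℝ → GraphSpace 𝔖.AB} {z' : GraphSpace 𝔖.AB} {t : ℝ}
    (hz : HasDerivAt z z' t) :
    HasDerivAt (fun s => 𝔖.storageOn hn hV (z s)) (2 * (𝔖.polarOn hn hV z' (z t)).re) t :=
  FormSpace.hasDerivAt_toFun hn
    (((𝔖.formState hn hV).restrictScalars ℝ).hasFDerivAt.comp_hasDerivAt t hz)

variable {hn} in
theorem dissipationForm_eq_polarOn
    {Ptilde : 𝒮.FormSpace hn →L[ℂ] (𝒮.FormSpace hn →L⋆[ℂ] ℂ)}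
    (hP : ∀ x z : 𝒮.FormSpace hn,
      polarForm 𝒮.toFun (FormSpace.equivDom hn x) (FormSpace.equivDom hn z) = conj (Ptilde z x))
    {w : 𝔖.W} {d : GraphSpace 𝔖.AB} (hd : 𝔖.stateOf d = 𝔖.applyAB (𝔖.ofWL w)) :
    𝔖.dissipationForm (supplyRate Q S R) Ptilde hV w =
      2 * (𝔖.polarOn hn hV d (𝔖.ofWL w)).re + 𝔖.supplyOn Q S R (𝔖.ofWL w) := by
  have h1 : 𝔖.formV hn hV (𝔖.applyABVL w) = 𝔖.formState hn hV d :=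
    FormSpace.embed_injective hn hd.symm
  rw [𝔖.dissipationForm_eq hV hP, h1]
  rfl

variable {hn} in
theorem dissipationForm_nonneg_of_isDissipative
    {Ptilde : 𝒮.FormSpace hn →L[ℂ] (𝒮.FormSpace hn →L⋆[ℂ] ℂ)}
    (hP : ∀ x z : 𝒮.FormSpace hn,
      polarForm 𝒮.toFun (FormSpace.equivDom hn x) (FormSpace.equivDom hn z) = conj (Ptilde z x))
    (hdiss : 𝔖.IsDissipative (supplyRate Q S R) 𝒮) (w : 𝔖.W) :
    0 ≤ 𝔖.dissipationForm (supplyRate Q S R) Ptilde hV w := by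
  have := GraphSpace.completeSpace 𝔖.AB 𝔖.AB_isClosed
  obtain ⟨v, hv⟩ := 𝔖.applyAB_mem_V w
  obtain ⟨ζ, hζ, h0, -, φ, hφ, hAB, hst⟩ := 𝔖.exists_constant_input_trajectory v
  -- `A&B (z t) = A&B w + ∫ A&B ζ` is the state of `ζ t`, that is, the derivative of the state of
  -- `z`. So `z` is a trajectory from `w`, differentiable in the graph norm.
  let z : ℝ → GraphSpace 𝔖.AB := fun t => 𝔖.ofWL w + ∫ s in (0 : ℝ)..t, ζ s
  have hz0 : z 0 = 𝔖.ofWL w := by simp [z]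
  have hzd : ∀ t, HasDerivAt z (ζ t) t := fun t =>
    (hasDerivAt_integral_of_continuous hζ 0 t).const_add _
  have hzc : Continuous z := continuous_iff_continuousAt.2 fun t => (hzd t).continuousAt
  have hzAB : ∀ t, 0 ≤ t → 𝔖.applyAB (z t) = 𝔖.stateOf (ζ t) := fun t ht => by
    have h1 : 𝔖.abL (∫ s in (0 : ℝ)..t, ζ s) = ∫ s in (0 : ℝ)..t, φ s := by
      rw [← ContinuousLinearMap.intervalIntegral_comp_comm _ (hζ.intervalIntegrable _ _)]
      refine intervalIntegral.integral_congr fun s hs => ?_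
      rw [uIcc_of_le ht] at hs
      exact hAB s hs.1
    rw [hst t ht, ← h1, hv]
    exact map_add 𝔖.applyAB _ _
  have hr := 𝔖.continuous_supplyOn Q S R
  -- The left side of the dissipation inequality as a function of the final time: it vanishes at
  -- `0`, and its derivative there is the dissipation form at `w`.
  have hderiv : HasDerivAt (fun t => 𝔖.storageOn hn hV (z t) - 𝔖.storageOn hn hV (z 0)
      + ∫ s in (0 : ℝ)..t, 𝔖.supplyOn Q S R (z s))
      (2 * (𝔖.polarOn hn hV (ζ 0) (z 0)).re + 𝔖.supplyOn Q S R (z 0)) 0 :=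
    ((𝔖.hasDerivAt_storageOn hn hV (hzd 0)).sub_const _).add
      (hasDerivAt_integral_of_continuous (hr.comp hzc) 0 0)
  rw [𝔖.dissipationForm_eq_polarOn Q S R hV hP (d := ζ 0) (by rw [h0]; exact hv), ← hz0]
  refine nonneg_deriv_of_nonneg_right hderiv (by simp) fun T hT => ?_
  obtain ⟨hd0, hdT, h⟩ := hdiss T hT _ _ _ <|
    𝔖.isClassicalTrajectory_of_path hT hzc fun t ht => by
      rw [hzAB t ht.1]
      exact ((𝔖.stateL.restrictScalars ℝ).hasFDerivAt.comp_hasDerivAt t (hzd t)).hasDerivWithinAt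
  rwa [𝔖.storageOn_eq hn hV (z T) rfl hdT, 𝔖.storageOn_eq hn hV (z 0) rfl hd0]

section average

variable {hn} {Ptilde : 𝒮.FormSpace hn →L[ℂ] (𝒮.FormSpace hn →L⋆[ℂ] ℂ)}
    (hP : ∀ x z : 𝒮.FormSpace hn,
      polarForm 𝒮.toFun (FormSpace.equivDom hn x) (FormSpace.equivDom hn z) = conj (Ptilde z x))
    (hpos : ∀ w : 𝔖.W, 0 ≤ 𝔖.dissipationForm (supplyRate Q S R) Ptilde hV w)

include hP hpos

theorem dissipation_forwardAverage {z : ℝ → GraphSpace 𝔖.AB} (hz : Continuous z) {T : ℝ}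
    (hd : ∀ t ∈ Icc 0 T,
      HasDerivWithinAt (fun s => 𝔖.stateOf (z s)) (𝔖.applyAB (z t)) (Icc 0 T) t)
    {b h : ℝ} (hb : 0 ≤ b) (hh : 0 < h) (hbh : b + h ≤ T) :
    0 ≤ 𝔖.storageOn hn hV (forwardAverage z h b) - 𝔖.storageOn hn hV (forwardAverage z h 0)
      + ∫ t in (0 : ℝ)..b, 𝔖.supplyOn Q S R (forwardAverage z h t) := by
  have := GraphSpace.completeSpace 𝔖.AB 𝔖.AB_isClosed
  have hcont : Continuous (forwardAverage z h) :=
    continuous_iff_continuousAt.2 fun t => (hasDerivAt_forwardAverage hz hh.ne' t).continuousAt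
  have hderiv : ∀ t, HasDerivAt (fun t => 𝔖.storageOn hn hV (forwardAverage z h t)
      + ∫ s in (0 : ℝ)..t, 𝔖.supplyOn Q S R (forwardAverage z h s))
      (2 * (𝔖.polarOn hn hV (h⁻¹ • (z (t + h) - z t)) (forwardAverage z h t)).re
        + 𝔖.supplyOn Q S R (forwardAverage z h t)) t := fun t =>
    (𝔖.hasDerivAt_storageOn hn hV (hasDerivAt_forwardAverage hz hh.ne' t)).add
      (hasDerivAt_integral_of_continuous ((𝔖.continuous_supplyOn Q S R).comp hcont) 0 t)
  have hmono := monotoneOn_of_hasDerivWithinAt_nonneg (convex_Icc 0 b)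
    (fun t _ => (hderiv t).continuousAt.continuousWithinAt)
    (fun t _ => (hderiv t).hasDerivWithinAt) fun t ht => by
      rw [interior_Icc] at ht
      -- `A&B` of the average is a difference quotient of the state, hence the state of an element
      -- of `dom (A&B)`; this puts the average in `W`.
      have hst : 𝔖.stateOf (h⁻¹ • (z (t + h) - z t)) = 𝔖.applyAB (forwardAverage z h t) := by
        have hsub : Icc t (t + h) ⊆ Icc 0 T := Icc_subset_Icc ht.1.le (by linarith [ht.2])
        have h1 : ∫ s in t..t + h, 𝔖.abL (z s) = 𝔖.stateOf (z (t + h)) - 𝔖.stateOf (z t) := by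
          refine intervalIntegral.integral_eq_sub_of_hasDerivAt_of_le (by linarith)
            (𝔖.stateL.continuous.comp hz).continuousOn (fun s hs => ?_)
            ((𝔖.abL.continuous.comp hz).intervalIntegrable _ _)
          have hs' := Ioo_subset_Ioo ht.1.le (by linarith [ht.2] : t + h ≤ T) hs
          exact (hd s (Ioo_subset_Icc_self hs')).hasDerivAt (Icc_mem_nhds hs'.1 hs'.2)
        rw [forwardAverage_eq hh.ne', ← 𝔖.abL_apply, ← 𝔖.stateL_apply,
          ContinuousLinearMap.map_smul_of_tower, ContinuousLinearMap.map_smul_of_tower,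
          ← ContinuousLinearMap.intervalIntegral_comp_comm _ (hz.intervalIntegrable _ _), h1,
          map_sub]
        rfl
      obtain ⟨w, hw⟩ := 𝔖.exists_ofWL_eq hst
      have := hpos w
      rwa [𝔖.dissipationForm_eq_polarOn Q S R hV hP (by rw [hw]; exact hst), hw] at this
  have := hmono (left_mem_Icc.2 hb) (right_mem_Icc.2 hb) hb
  simp only [intervalIntegral.integral_same] at this
  linarith

/-- Averages look ahead by `h`, so `h → 0` is taken on `[0, b]` with `b < T`; continuity in `b` then
reaches `T`. -/
theorem dissipation_path {z : ℝ → GraphSpace 𝔖.AB} (hz : Continuous z) {T : ℝ} (hT : 0 < T)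
    (hd : ∀ t ∈ Icc 0 T,
      HasDerivWithinAt (fun s => 𝔖.stateOf (z s)) (𝔖.applyAB (z t)) (Icc 0 T) t) :
    0 ≤ 𝔖.storageOn hn hV (z T) - 𝔖.storageOn hn hV (z 0)
      + ∫ t in (0 : ℝ)..T, 𝔖.supplyOn Q S R (z t) := by
  have := GraphSpace.completeSpace 𝔖.AB 𝔖.AB_isClosed
  have hs := 𝔖.continuous_storageOn hn hV
  have hr := 𝔖.continuous_supplyOn Q S R
  have hav := forwardAverage_continuous hz
  have hlt : ∀ b, 0 ≤ b → b < T → 0 ≤ 𝔖.storageOn hn hV (z b) - 𝔖.storageOn hn hV (z 0)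
      + ∫ t in (0 : ℝ)..b, 𝔖.supplyOn Q S R (z t) := by
    intro b hb hbT
    have hc : Continuous fun h => 𝔖.storageOn hn hV (forwardAverage z h b)
        - 𝔖.storageOn hn hV (forwardAverage z h 0)
        + ∫ t in (0 : ℝ)..b, 𝔖.supplyOn Q S R (forwardAverage z h t) :=
      ((hs.comp (hav.comp (by fun_prop : Continuous fun h : ℝ => (h, b)))).sub
        (hs.comp (hav.comp (by fun_prop : Continuous fun h : ℝ => (h, (0 : ℝ)))))).add
      (intervalIntegral.continuous_parametric_intervalIntegral_of_continuous'
        (f := fun h t => 𝔖.supplyOn Q S R (forwardAverage z h t)) (hr.comp hav) 0 b)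
    have hlim := (hc.tendsto 0).mono_left (nhdsWithin_le_nhds (s := Ioi 0))
    simp only [forwardAverage_zero] at hlim
    refine ge_of_tendsto hlim ?_
    filter_upwards [Ioo_mem_nhdsGT (sub_pos.2 hbT)] with h hh
    exact 𝔖.dissipation_forwardAverage Q S R hV hP hpos hz hd hb hh.1 (by linarith [hh.2])
  have hc : Continuous fun b => 𝔖.storageOn hn hV (z b) - 𝔖.storageOn hn hV (z 0)
      + ∫ t in (0 : ℝ)..b, 𝔖.supplyOn Q S R (z t) :=
    ((hs.comp hz).sub continuous_const).add (intervalIntegral.continuous_primitive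
      (fun a b => (hr.comp hz).intervalIntegrable a b) 0)
  refine ge_of_tendsto ((hc.tendsto T).mono_left (nhdsWithin_le_nhds (s := Iio T))) ?_
  filter_upwards [Ioo_mem_nhdsLT hT] with b hb using hlt b hb.1.le hb.2

theorem isDissipative_of_dissipationForm_nonneg : 𝔖.IsDissipative (supplyRate Q S R) 𝒮 := by
  intro T hT x u y hxuy
  obtain ⟨z, hz, h⟩ := IsClassicalTrajectory.exists_graph_path 𝔖 hT hxuy
  -- The constant extension beyond `[0, T]` gives a path continuous on all of `ℝ`.
  let z' : ℝ → GraphSpace 𝔖.AB := IccExtend hT.le ((Icc 0 T).domRestrict z)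
  have hz' : Continuous z' := (continuousOn_iff_continuous_domRestrict.1 hz).Icc_extend'
  have heq : ∀ t ∈ Icc 0 T, z' t = z t := fun t ht => IccExtend_of_mem hT.le _ ht
  have h0 : (0 : ℝ) ∈ Icc 0 T := left_mem_Icc.2 hT.le
  have h1 : T ∈ Icc 0 T := right_mem_Icc.2 hT.le
  have hdom : ∀ t ∈ Icc 0 T, x t ∈ 𝒮.dom := fun t ht => hV ⟨z t, (h t ht).1⟩
  refine ⟨hdom 0 h0, hdom T h1, ?_⟩
  have key := 𝔖.dissipation_path Q S R hV hP hpos hz' hT fun t ht => by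
    rw [heq t ht]
    exact (h t ht).2.2.2.congr (fun r hr => by rw [heq r hr, (h r hr).1])
      (by rw [heq t ht, (h t ht).1])
  rw [𝔖.storageOn_eq hn hV (z' T) (by rw [heq T h1, (h T h1).1]) (hdom T h1),
    𝔖.storageOn_eq hn hV (z' 0) (by rw [heq 0 h0, (h 0 h0).1]) (hdom 0 h0)] at key
  refine key.trans_eq (congrArg _ (intervalIntegral.integral_congr fun t ht => ?_))
  rw [uIcc_of_le hT.le] at ht
  simp only [supplyOn]
  rw [heq t ht, (h t ht).2.1, (h t ht).2.2.1]

end average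

end SystemNode

end

/-! ### The equivalence -/

theorem theorem3p4 {X : Type uX} {U : Type uU} {Y : Type uY}
    [NormedAddCommGroup X] [InnerProductSpace ℂ X] [CompleteSpace X]
    [NormedAddCommGroup U] [InnerProductSpace ℂ U] [CompleteSpace U]
    [NormedAddCommGroup Y] [InnerProductSpace ℂ Y] [CompleteSpace Y]
    (𝔖 : SystemNode X U Y)
    (Q : Y →L[ℂ] Y) (S : U →L[ℂ] Y) (R : U →L[ℂ] U)
    (hQ : IsSelfAdjoint Q) (hR : IsSelfAdjoint R)
    (𝒮 : RealQuadraticForm X) (ε c : ℝ)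
    (hsemibounded : 𝒮.IsNormShift ε c)
    (hclosed : CompleteSpace (𝒮.FormSpace hsemibounded))
    (hdense : Dense (𝒮.dom : Set X))
    (Ptilde : 𝒮.FormSpace hsemibounded →L[ℂ] (𝒮.FormSpace hsemibounded →L⋆[ℂ] ℂ))
    (hPtilde : ∀ x z : 𝒮.FormSpace hsemibounded,
      polarForm 𝒮.toFun (RealQuadraticForm.FormSpace.equivDom hsemibounded x)
        (RealQuadraticForm.FormSpace.equivDom hsemibounded z) = conj (Ptilde z x)) :
    List.TFAE
      [ 𝔖.IsDissipative (supplyRate Q S R) 𝒮,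
        ∃ hV : 𝔖.V ≤ 𝒮.dom, ∃ W' : Submodule ℂ 𝔖.W, Dense (W' : Set 𝔖.W) ∧
          ∀ w ∈ W', 0 ≤ 𝔖.dissipationForm (supplyRate Q S R) Ptilde hV w,
        ∃ hV : 𝔖.V ≤ 𝒮.dom,
          ∀ w : 𝔖.W, 0 ≤ 𝔖.dissipationForm (supplyRate Q S R) Ptilde hV w,
        ∃ hV : 𝔖.V ≤ 𝒮.dom,
          ∃ (Z : Type (max uX uU)) (_ : NormedAddCommGroup Z) (_ : InnerProductSpace ℂ Z)
            (_ : CompleteSpace Z) (KL : 𝔖.W →L[ℂ] Z), DenseRange KL ∧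
            ∀ w : 𝔖.W,
              𝔖.dissipationForm (supplyRate Q S R) Ptilde hV w = ‖KL w‖ ^ 2 ] := by
  have hcont := fun hV : 𝔖.V ≤ 𝒮.dom => 𝔖.continuous_dissipationForm hV Q S R hPtilde
  tfae_have 1 → 3 := fun h => ⟨𝔖.V_le_of_isDissipative h,
    𝔖.dissipationForm_nonneg_of_isDissipative Q S R _ hPtilde h⟩
  tfae_have 3 → 1 := fun ⟨hV, h⟩ => 𝔖.isDissipative_of_dissipationForm_nonneg Q S R hV hPtilde h
  tfae_have 3 → 2 := fun ⟨hV, h⟩ => ⟨hV, ⊤, by simp, fun w _ => h w⟩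
  tfae_have 2 → 3 := fun ⟨hV, W', hW', h⟩ => ⟨hV, fun w =>
    closure_minimal (fun w hw => h w hw) (isClosed_le continuous_const (hcont hV)) (hW' w)⟩
  tfae_have 3 → 4 := by
    rintro ⟨hV, h⟩
    have hre := 𝔖.re_dissipationInner_self hV Q S R hPtilde
    obtain ⟨Z, i1, i2, i3, KL, hKL, hnorm⟩ := exists_hilbert_factorization
      (𝔖.dissipationCore hV S hPtilde hQ hR h) ((hcont hV).congr fun w => (hre w).symm)
    exact ⟨hV, Z, i1, i2, i3, KL, hKL, fun w => (hre w).symm.trans (hnorm w)⟩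
  tfae_have 4 → 3 := fun ⟨hV, _, _, _, _, _, _, h⟩ => ⟨hV, fun w => h w ▸ sq_nonneg _⟩
  tfae_finish
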